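/- **Setting.** Two users $i\in\{1,2\}$ share a Gaussian interference channel with time slots $t$; $i'=3-i$ is the other user, and all logarithms have base $2$. Let $k_i,N_i\ge 1$ be integers, $0<q_i\le 1$, $\theta_i,\nu_i,\gamma_i>0$, $a_i\ge 0$, and let $n'=n'(n)$ be nonnegative integers with $n'/n\to 0$. Put $$\eta_i=\frac{k_i}{N_i},\quad \lambda_i=k_iq_i,\quad \mu_i=\frac{\eta_i}{\lambda_i},\quad n_i=\lfloor n\theta_i\rfloor,\quad \mathsf C(x)=\tfrac12\log(1+x),\quad \phi_i=\mathsf C(\gamma_i),\quad \psi_i=\mathsf C\Big(\frac{\gamma_i}{1+a_{i'}\gamma_{i'}}\Big).$$ *Transmission.* Starting at slot $\lfloor n\nu_i\rfloor$, at the end of each slot a packet of $k_i$ bits enters the initially empty buffer of Tx $i$ with probability $q_i$, independently over slots and users; the source turns off after $n$ packets. Let $\tau_i^{(j)}$ ($1\le j\le N_i$) be the first slot $t$ (with $t\ge\lfloor n\nu_i\rfloor$ if $j=1$ and $t\ge\tau_i^{(j-1)}+n'+n_i$ if $j\ge2$) at whose end the buffer of Tx $i$ contains at least $\lfloor n\eta_i\rfloor$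 bits. Then $\lfloor n\eta_i\rfloor$ bits leave the buffer, and Tx $i$ sends its $j$-th burst: its preamble (of length $n'$, the same in all its bursts) during the slots $\tau_i^{(j)}+1,\dots,\tau_i^{(j)}+n'$, and then its $j$-th codeword, of length $n_i$, during $\tau_i^{(j)}+n'+1,\dots,\tau_i^{(j)}+n'+n_i$. Outside its bursts $x_{i,t}=0$. The codebook of Tx $i$ has one codeword for each of $2^{\lfloor n\eta_i\rfloor}$ messages; all codeword and preamble symbols of Tx $i$ are i.i.d. $\mathrm N(0,\gamma_i)$. Rx $i$ receives $y_{i,t}=x_{i,t}+\sqrt{a_{i'}}\,x_{i',t}+z_{i,t}$ with i.i.d. $\mathrm N(0,1)$ noise. Arrivals, codebooks, preambles and noise are independent. *Decoding.* Rx $i$ knows all the times $\tau_1^{(\cdot)},\tau_2^{(\cdot)}$ and the codebook of Tx $i$. The bursts of Tx $i'$ divide the slots of the $j$-th codeword of Tx $i$ into segments: for each burst of Tx $i'$ the slots that lie in it, and for each idle period of Tx $i'$ (before its first burst, between two consecutive bursts, after its last burst) the slots that lie in it. Let $\mathrm g(\cdot\,;\sigma^2)$ be the $\mathrm N(0,\sigma^2)$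 density. For $\epsilon>0$, Rx $i$ looks for the unique message whose codeword is, on every nonempty segment, $\epsilon$-jointly typical with the received signal, with respect to the density $\mathrm g(x;\gamma_i)\,\mathrm g(y-x;1+a_{i'}\gamma_{i'})$ on segments in a burst of Tx $i'$, and $\mathrm g(x;\gamma_i)\,\mathrm g(y-x;1)$ on the others. (Vectors $\vec x,\vec y\in\mathbb R^m$ are $\epsilon$-jointly typical with respect to a density $p$ with marginals $p_1,p_2$ if $|\frac1m\sum_l\log p_1(x_l)+h(p_1)|$, $|\frac1m\sum_l\log p_2(y_l)+h(p_2)|$ and $|\frac1m\sum_l\log p(x_l,y_l)+h(p)|$ are all less than $\epsilon$, $h$ being differential entropy.) A decoding error occurs if the transmitted message is not the unique message that passes this test. The $j$-th message of Tx $i$ is *decoded reliably* if for every sufficiently small $\epsilon>0$ the probability of a decoding error at Rx $i$ (over arrivals, codebooks, preambles and noise) tends to $0$ as $n\to\infty$, whatever messages the two users send. *Interference pattern.* For $1\le m\le N_{i'}$ put $\rho_m=m\mu_{i'}-j\mu_i+\nu_{i'}-\nu_i$. Let $\omega^-_{i,j}$ be the index $m$ with $-\theta_{i'}<\rho_m<\min\{0,\theta_i-\theta_{i'}\}$,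 and $\omega^+_{i,j}$ the index $m$ with $\max\{0,\theta_i-\theta_{i'}\}<\rho_m<\theta_i$, each being $0$ if there is no such index (under the assumptions below there is at most one). Let $\omega_{i,j}$ be the number of $m$ with $(m\mu_{i'}+\nu_{i'},\,m\mu_{i'}+\nu_{i'}+\theta_{i'})\subseteq(j\mu_i+\nu_i,\,j\mu_i+\nu_i+\theta_i)$. **Proposition.** Assume that $\theta_i<\mu_i$ for each $i\in\{1,2\}$ with $N_i>1$, and that $j_2\mu_2-j_1\mu_1+\nu_2-\nu_1\notin\{0,\theta_1,-\theta_2,\theta_1-\theta_2\}$ for all $1\le j_1\le N_1$, $1\le j_2\le N_2$. Let $i\in\{1,2\}$ and $1\le j\le N_i$ with $\omega^-_{i,j}\ne0$ and $\omega^+_{i,j}=0$. If $$\Big(1-\frac{j}{\lambda_i}(\phi_i-\psi_i)\Big)\eta_i+\frac{\omega^-_{i,j}}{\lambda_{i'}}(\phi_i-\psi_i)\eta_{i'}<\theta_i\phi_i-\big(\nu_{i'}-\nu_i+\theta_{i'}(1+\omega_{i,j})\big)(\phi_i-\psi_i),$$ then the $j$-th message of Tx $i$ is decoded reliably. -/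

import Mathlib

open MeasureTheory ProbabilityTheory Filter Topology
open scoped NNReal ENNReal

noncomputable section

namespace GIC

/-- `C(x) = (1/2) log₂ (1 + x)`. -/
def capFun (x : ℝ) : ℝ := 1 / 2 * Real.logb 2 (1 + x)

/-! ### Densities, differential entropy and joint typicality (all logarithms have base 2) -/

/-- Differential entropy of a density on `ℝ`. -/
def entropy₁ (f : ℝ → ℝ) : ℝ := -∫ x, f x * Real.logb 2 (f x)

/-- Differential entropy of a density on `ℝ²`. -/
def entropy₂ (p : ℝ → ℝ → ℝ) : ℝ := -∫ z : ℝ × ℝ, p z.1 z.2 * Real.logb 2 (p z.1 z.2)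

/-- First marginal of a density on `ℝ²`. -/
def marginal₁ (p : ℝ → ℝ → ℝ) (x : ℝ) : ℝ := ∫ y, p x y

/-- Second marginal of a density on `ℝ²`. -/
def marginal₂ (p : ℝ → ℝ → ℝ) (y : ℝ) : ℝ := ∫ x, p x y

/-- The vectors `(x t)_{t ∈ S}` and `(y t)_{t ∈ S}` are `ε`-jointly typical with respect to the
density `p`. -/
def JointlyTypical (ε : ℝ) (p : ℝ → ℝ → ℝ) (S : Finset ℕ) (x y : ℕ → ℝ) : Prop :=
  |(∑ t ∈ S, Real.logb 2 (marginal₁ p (x t))) / (S.card : ℝ) + entropy₁ (marginal₁ p)| < ε ∧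
  |(∑ t ∈ S, Real.logb 2 (marginal₂ p (y t))) / (S.card : ℝ) + entropy₁ (marginal₂ p)| < ε ∧
  |(∑ t ∈ S, Real.logb 2 (p (x t) (y t))) / (S.card : ℝ) + entropy₂ p| < ε

/-- The block `v` of length `L` sent during the time slots `start, …, start + L - 1`, viewed as a
signal on the whole time axis that is zero outside of these slots. -/
def place {L : ℕ} (v : Fin L → ℝ) (start t : ℕ) : ℝ :=
  if h : start ≤ t ∧ t < start + L then v ⟨t - start, by omega⟩ else 0

/-! ### The channel with stochastic data arrival -/

/-- The parameters of a two-user Gaussian interference channel with stochastic data arrival.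
The two users are the elements of `Fin 2`; the user other than `i` is `i.rev`. -/
structure Params where
  /-- number of bits in an arriving packet -/
  k : Fin 2 → ℕ
  /-- probability that a packet arrives in a time slot -/
  q : Fin 2 → unitInterval
  /-- number of codewords sent -/
  N : Fin 2 → ℕ
  /-- normalized codeword length -/
  θ : Fin 2 → ℝ
  /-- normalized activation time -/
  ν : Fin 2 → ℝ
  /-- `√(a i)` is the gain of the cross link leaving transmitter `i` -/
  a : Fin 2 → ℝ≥0
  /-- variance of the Gaussian symbols sent by transmitter `i` -/
  γ : Fin 2 → ℝ≥0
  /-- length of the preamble, as a function of `n` -/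
  preLen : ℕ → ℕ
  k_pos : ∀ i, 0 < k i
  q_pos : ∀ i, 0 < q i
  N_pos : ∀ i, 0 < N i
  θ_pos : ∀ i, 0 < θ i
  ν_pos : ∀ i, 0 < ν i
  γ_pos : ∀ i, 0 < γ i
  preLen_isLittleO : Tendsto (fun n : ℕ => (preLen n : ℝ) / (n : ℝ)) atTop (𝓝 0)

namespace Params

variable (P : Params)

/-- `η_i = k_i / N_i`. -/
def η (i : Fin 2) : ℝ := (P.k i : ℝ) / (P.N i : ℝ)

/-- The rate of data arrival, `λ_i = k_i q_i`. -/
def rate (i : Fin 2) : ℝ := (P.k i : ℝ) * (P.q i : ℝ)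

/-- `μ_i = η_i / λ_i`. -/
def μ (i : Fin 2) : ℝ := P.η i / P.rate i

/-- `φ_i = C(γ_i)`. -/
def φ (i : Fin 2) : ℝ := capFun (P.γ i : ℝ)

/-- `ψ_i = C(γ_i / (1 + a_{i'} γ_{i'}))`. -/
def ψ (i : Fin 2) : ℝ := capFun ((P.γ i : ℝ) / (1 + (P.a i.rev : ℝ) * (P.γ i.rev : ℝ)))

/-! #### Relative positions of the bursts on the scaled time axis -/

/-- Offset on the scaled time axis of the start of the `m`-th burst of the other user from the
start of the `j`-th codeword of user `i`. -/
def offset (i : Fin 2) (j m : ℕ) : ℝ :=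
  (m : ℝ) * P.μ i.rev - (j : ℝ) * P.μ i + P.ν i.rev - P.ν i

/-- `ω⁻_{i,j}`: the index of the burst of the other user that overlaps with the left end of the
`j`-th codeword of user `i`, and `0` if there is none (`sInf ∅ = 0` in `ℕ`). -/
def omegaMinus (i : Fin 2) (j : ℕ) : ℕ :=
  sInf {m : ℕ | m ∈ Finset.Icc 1 (P.N i.rev) ∧
    -P.θ i.rev < P.offset i j m ∧ P.offset i j m < min 0 (P.θ i - P.θ i.rev)}

/-- `ω⁺_{i,j}`: the index of the burst of the other user that overlaps with the right end of the
`j`-th codeword of user `i`, and `0` if there is none (`sInf ∅ = 0` in `ℕ`). -/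
def omegaPlus (i : Fin 2) (j : ℕ) : ℕ :=
  sInf {m : ℕ | m ∈ Finset.Icc 1 (P.N i.rev) ∧
    max 0 (P.θ i - P.θ i.rev) < P.offset i j m ∧ P.offset i j m < P.θ i}

/-- `ω_{i,j}`: the number of bursts of the other user that are completely contained within the
`j`-th codeword of user `i`. -/
def omega (i : Fin 2) (j : ℕ) : ℕ :=
  Set.ncard {m : ℕ | m ∈ Finset.Icc 1 (P.N i.rev) ∧
    (j : ℝ) * P.μ i + P.ν i ≤ (m : ℝ) * P.μ i.rev + P.ν i.rev ∧
    (m : ℝ) * P.μ i.rev + P.ν i.rev + P.θ i.rev ≤ (j : ℝ) * P.μ i + P.ν i + P.θ i}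

/-- The endpoints of the scaled bursts of the two users do not coincide:
`j₂ μ₂ - j₁ μ₁ + ν₂ - ν₁ ∉ {0, θ₁, -θ₂, θ₁ - θ₂}` for `1 ≤ j₁ ≤ N₁` and `1 ≤ j₂ ≤ N₂`. -/
def NoCoincidence : Prop :=
  ∀ j₁ ∈ Finset.Icc 1 (P.N 0), ∀ j₂ ∈ Finset.Icc 1 (P.N 1),
    (j₂ : ℝ) * P.μ 1 - (j₁ : ℝ) * P.μ 0 + P.ν 1 - P.ν 0 ∉
      ({0, P.θ 0, -P.θ 1, P.θ 0 - P.θ 1} : Set ℝ)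

/-- The constraint `θ_i < μ_i`, imposed on a transmitter that sends more than one codeword. -/
def Immediate : Prop := ∀ i, 1 < P.N i → P.θ i < P.μ i

/-! #### Random ingredients for a given `n` -/

/-- Number of bits represented by a codeword, `⌊n η_i⌋`. -/
def bits (n : ℕ) (i : Fin 2) : ℕ := ⌊(n : ℝ) * P.η i⌋₊

/-- Codeword length, `n_i = ⌊n θ_i⌋`. -/
def len (n : ℕ) (i : Fin 2) : ℕ := ⌊(n : ℝ) * P.θ i⌋₊

/-- The time slot `⌊n ν_i⌋` at which the bit stream of user `i` starts. -/
def start (n : ℕ) (i : Fin 2) : ℕ := ⌊(n : ℝ) * P.ν i⌋₊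

/-- The set of messages of user `i`, of size `2 ^ ⌊n η_i⌋`. -/
abbrev Msg (n : ℕ) (i : Fin 2) : Type := Fin (2 ^ P.bits n i)

/-- Arrival indicators of the packets of each user in each time slot. -/
abbrev Arrivals : Type := Fin 2 → ℕ → Bool

/-- The codebooks of both users. -/
abbrev Codebooks (n : ℕ) : Type := (i : Fin 2) → P.Msg n i → Fin (P.len n i) → ℝ

/-- The preamble sequences of both users. -/
abbrev Preambles (n : ℕ) : Type := Fin 2 → Fin (P.preLen n) → ℝ

/-- The additive noise at each receiver in each time slot. -/
abbrev Noise : Type := Fin 2 → ℕ → ℝ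

/-- The sample space: arrivals, codebooks, preambles and noise. -/
abbrev Sample (n : ℕ) : Type := Arrivals × P.Codebooks n × P.Preambles n × Noise

/-- Independent Bernoulli(`q_i`) arrivals. -/
def arrivalLaw : Measure Arrivals :=
  Measure.pi fun i => Measure.infinitePi fun _ : ℕ =>
    bernoulliMeasure true false (P.q i)

/-- Independent N(0, `γ_i`) codeword symbols. -/
def codebookLaw (n : ℕ) : Measure (P.Codebooks n) :=
  Measure.pi fun i => Measure.pi fun _ => Measure.pi fun _ => gaussianReal 0 (P.γ i)

/-- Independent N(0, `γ_i`) preamble symbols. -/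
def preambleLaw (n : ℕ) : Measure (P.Preambles n) :=
  Measure.pi fun i => Measure.pi fun _ => gaussianReal 0 (P.γ i)

/-- White Gaussian noise of unit variance at both receivers. -/
def noiseLaw : Measure Noise :=
  Measure.pi fun _ => Measure.infinitePi fun _ : ℕ => gaussianReal 0 1

/-- Arrivals, codebooks, preambles and noise are independent. -/
def law (n : ℕ) : Measure (P.Sample n) :=
  P.arrivalLaw.prod ((P.codebookLaw n).prod ((P.preambleLaw n).prod noiseLaw))

/-! #### Transmission -/

/-- Number of packets that have arrived at the buffer of user `i` by the end of slot `t`. The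
stream starts at slot `⌊n ν_i⌋`, and the source turns off permanently after `n` packets, that is,
`k_i n` bits. -/
def packets (n : ℕ) (i : Fin 2) (α : ℕ → Bool) (t : ℕ) : ℕ :=
  min n ((Finset.Icc (P.start n i) t).filter fun s => α s = true).card

/-- `τ_i^{(j)}`: the slot at whose end the `j`-th group of `⌊n η_i⌋` bits is taken out of the
buffer; the `j`-th burst starts in the next slot. It is the first slot, not before the last slot
of the previous burst, at whose end the buffer holds at least `⌊n η_i⌋` bits. When `j` groups have
been taken out, the buffer content is the number of bits that have arrived minus `j ⌊n η_i⌋`. -/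
def schedTime (n : ℕ) (i : Fin 2) (α : ℕ → Bool) : ℕ → ℕ
  | 0 => P.start n i
  | j + 1 =>
    sInf {t : ℕ |
      (if j = 0 then P.start n i else schedTime n i α j + P.preLen n + P.len n i) ≤ t ∧
      (j + 1) * P.bits n i ≤ P.k i * P.packets n i α t}

variable {P}

/-- `τ_i^{(j)}` as a random variable. -/
def tau {n : ℕ} (s : P.Sample n) (i : Fin 2) (j : ℕ) : ℕ := P.schedTime n i (s.1 i) j

/-- The signal of transmitter `i`, when `w j` is the message carried by its `j`-th burst: in the
`j`-th burst, the preamble is sent during the slots `τ_i^{(j)} + 1, …, τ_i^{(j)} + n'`, and the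
codeword during `τ_i^{(j)} + n' + 1, …, τ_i^{(j)} + n' + n_i`. The bursts of one transmitter never
overlap, so at most one summand differs from zero. -/
def signal {n : ℕ} (s : P.Sample n) (i : Fin 2) (w : ℕ → P.Msg n i) (t : ℕ) : ℝ :=
  ∑ j ∈ Finset.Icc 1 (P.N i),
    (place (s.2.2.1 i) (tau s i j + 1) t +
      place (s.2.1 i (w j)) (tau s i j + P.preLen n + 1) t)

/-- The signal at receiver `i`. -/
def received {n : ℕ} (s : P.Sample n) (w : (i : Fin 2) → ℕ → P.Msg n i) (i : Fin 2) (t : ℕ) : ℝ :=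
  signal s i (w i) t + Real.sqrt (P.a i.rev) * signal s i.rev (w i.rev) t + s.2.2.2 i t

/-! #### Decoding -/

/-- The slots during which the `j`-th codeword of user `i` is sent. -/
def window {n : ℕ} (s : P.Sample n) (i : Fin 2) (j : ℕ) : Finset ℕ :=
  Finset.Icc (tau s i j + P.preLen n + 1) (tau s i j + P.preLen n + P.len n i)

/-- The slots of the `j`-th codeword of user `i` that lie in the `m`-th burst of the other user. -/
def interfered {n : ℕ} (s : P.Sample n) (i : Fin 2) (j m : ℕ) : Finset ℕ :=
  (window s i j).filter fun t =>
    tau s i.rev m + 1 ≤ t ∧ t ≤ tau s i.rev m + P.preLen n + P.len n i.rev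

/-- The slots of the `j`-th codeword of user `i` that lie after the `m`-th and before the
`(m + 1)`-st burst of the other user, for `0 ≤ m ≤ N_{i'}` (before the first burst if `m = 0`,
after the last one if `m = N_{i'}`). -/
def clean {n : ℕ} (s : P.Sample n) (i : Fin 2) (j m : ℕ) : Finset ℕ :=
  (window s i j).filter fun t =>
    (m = 0 ∨ tau s i.rev m + P.preLen n + P.len n i.rev < t) ∧
    (m = P.N i.rev ∨ t < tau s i.rev (m + 1) + 1)

variable (P)

/-- Joint density of transmitted and received symbol at user `i` without interference. -/
def densClean (i : Fin 2) (x y : ℝ) : ℝ :=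
  gaussianPDFReal 0 (P.γ i) x * gaussianPDFReal 0 1 (y - x)

/-- Joint density of transmitted and received symbol at user `i` in the presence of
interference. -/
def densInterf (i : Fin 2) (x y : ℝ) : ℝ :=
  gaussianPDFReal 0 (P.γ i) x * gaussianPDFReal 0 (1 + P.a i.rev * P.γ i.rev) (y - x)

variable {P}

/-- The codeword of message `m` of user `i` passes the test of receiver `i` for the `j`-th codeword:
on each (nonempty) segment of the codeword it is jointly typical with the received signal `y`, with
respect to the density that corresponds to the presence or absence of interference there. -/
def Passes {n : ℕ} (s : P.Sample n) (ε : ℝ) (i : Fin 2) (j : ℕ) (y : ℕ → ℝ) (m : P.Msg n i) :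
    Prop :=
  (∀ r ∈ Finset.Icc 1 (P.N i.rev), (interfered s i j r).Nonempty →
    JointlyTypical ε (P.densInterf i) (interfered s i j r)
      (place (s.2.1 i m) (tau s i j + P.preLen n + 1)) y) ∧
  (∀ r ∈ Finset.Icc 0 (P.N i.rev), (clean s i j r).Nonempty →
    JointlyTypical ε (P.densClean i) (clean s i j r)
      (place (s.2.1 i m) (tau s i j + P.preLen n + 1)) y)

variable (P)

/-- The event that receiver `i` fails to decode the `j`-th message of user `i`: the transmitted
message is not the unique message that passes the test. -/
def decodingError (n : ℕ) (ε : ℝ) (w : (i : Fin 2) → ℕ → P.Msg n i) (i : Fin 2) (j : ℕ) :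
    Set (P.Sample n) :=
  {s | ¬ ∀ m : P.Msg n i, Passes s ε i j (received s w i) m ↔ m = w i j}

/-- Reliable decoding of the `j`-th message of user `i`: for every sufficiently small typicality
threshold `ε` the probability of a decoding error vanishes as `n → ∞`, whatever messages are sent
by the two users. -/
def ReliableDecoding (i : Fin 2) (j : ℕ) : Prop :=
  ∃ ε₀ : ℝ, 0 < ε₀ ∧ ∀ ε : ℝ, 0 < ε → ε < ε₀ →
    ∀ w : (n : ℕ) → (i : Fin 2) → ℕ → P.Msg n i,
      Tendsto (fun n : ℕ => P.law n (P.decodingError n ε (w n) i j)) atTop (𝓝 0)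

end Params

end GIC

end

noncomputable section

namespace GIC

/-- The base-2 logarithm of the centered Gaussian density of variance `v`. -/
def logGauss (v : ℝ≥0) (x : ℝ) : ℝ := Real.logb 2 (gaussianPDFReal 0 v x)

/-- The joint density of `X ∼ N(0, γ)` and `X + U` with independent `U ∼ N(0, σ)`. -/
def jointPDF (γ σ : ℝ≥0) (x y : ℝ) : ℝ := gaussianPDFReal 0 γ x * gaussianPDFReal 0 σ (y - x)

theorem logGauss_eq {v : ℝ≥0} (hv : v ≠ 0) (x : ℝ) :
    logGauss v x = -(1 / 2 * Real.logb 2 (2 * Real.pi * v)) - x ^ 2 / (2 * v * Real.log 2) := by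
  have hv' : (0 : ℝ) < v := by positivity
  have h2 : Real.log 2 ≠ 0 := by positivity
  have hp : (0 : ℝ) < 2 * Real.pi * v := by positivity
  rw [logGauss, gaussianPDFReal, Real.logb, Real.log_mul (by positivity) (by positivity),
    Real.log_exp, Real.log_inv, Real.log_sqrt hp.le, Real.logb]
  field_simp
  ring

theorem measurable_logGauss (v : ℝ≥0) : Measurable (logGauss v) := by
  unfold logGauss
  exact (Real.measurable_log.comp (measurable_gaussianPDFReal 0 v)).div_const _

theorem memLp_sq_gaussianReal (v : ℝ≥0) : MemLp (fun x : ℝ => x ^ 2) 2 (gaussianReal 0 v) := by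
  rw [memLp_two_iff_integrable_sq (by fun_prop)]
  have h := (memLp_id_gaussianReal (μ := 0) (v := v) 4).integrable_norm_pow (p := 4) (by norm_num)
  refine h.congr (Eventually.of_forall fun x => ?_)
  simp only [id, Real.norm_eq_abs, ← pow_mul]
  exact (show Even 4 by decide).pow_abs x

theorem memLp_logGauss {v : ℝ≥0} (hv : v ≠ 0) : MemLp (logGauss v) 2 (gaussianReal 0 v) := by
  have : logGauss v = fun x => -(1 / 2 * Real.logb 2 (2 * Real.pi * v)) -
      (2 * v * Real.log 2)⁻¹ * x ^ 2 := by
    funext x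
    rw [logGauss_eq hv, div_eq_inv_mul (x ^ 2)]
  rw [this]
  exact (memLp_const _).sub ((memLp_sq_gaussianReal v).const_mul _)

theorem integral_sq_gaussianReal (v : ℝ≥0) : ∫ x, x ^ 2 ∂gaussianReal 0 v = v := by
  have h := variance_fun_id_gaussianReal (μ := 0) (v := v)
  rw [variance_eq_integral measurable_id'.aemeasurable] at h
  simpa using h

theorem integral_logGauss {v : ℝ≥0} (hv : v ≠ 0) :
    ∫ x, logGauss v x ∂gaussianReal 0 v =
      -(1 / 2 * Real.logb 2 (2 * Real.pi * v)) - 1 / (2 * Real.log 2) := by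
  have hv' : (v : ℝ) ≠ 0 := by positivity
  have h2 : Real.log 2 ≠ 0 := by positivity
  simp_rw [logGauss_eq hv]
  rw [integral_sub (integrable_const _)
    (((memLp_sq_gaussianReal v).integrable (by norm_num)).div_const _), integral_div,
    integral_sq_gaussianReal]
  simp
  field_simp

theorem integral_logGauss_eq_neg_entropy {v : ℝ≥0} (hv : v ≠ 0) :
    ∫ x, logGauss v x ∂gaussianReal 0 v = -entropy₁ (gaussianPDFReal 0 v) := by
  rw [integral_gaussianReal_eq_integral_smul hv, entropy₁, neg_neg]
  rfl

theorem entropy₁_gaussian {v : ℝ≥0} (hv : v ≠ 0) :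
    entropy₁ (gaussianPDFReal 0 v) =
      1 / 2 * Real.logb 2 (2 * Real.pi * v) + 1 / (2 * Real.log 2) := by
  have h := integral_logGauss hv
  rw [integral_logGauss_eq_neg_entropy hv] at h
  linarith

theorem entropy₁_gaussian_sub {γ σ : ℝ≥0} (hγ : γ ≠ 0) (hσ : σ ≠ 0) :
    entropy₁ (gaussianPDFReal 0 (γ + σ)) - entropy₁ (gaussianPDFReal 0 σ) = capFun (γ / σ) := by
  have hγ' : (0 : ℝ) < γ := by positivity
  have hσ' : (0 : ℝ) < σ := by positivity
  rw [entropy₁_gaussian hσ, entropy₁_gaussian (by positivity), capFun]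
  have : 1 + (γ : ℝ) / σ = (2 * Real.pi * (γ + σ)) / (2 * Real.pi * σ) := by
    field_simp
    ring
  rw [this, Real.logb_div (by positivity) (by positivity)]
  push_cast
  ring

theorem jointPDF_factor {γ σ : ℝ≥0} (hγ : γ ≠ 0) (hσ : σ ≠ 0) (x y : ℝ) :
    jointPDF γ σ x y = gaussianPDFReal 0 (γ + σ) y *
      gaussianPDFReal (y * (γ / (γ + σ))) (γ * σ / (γ + σ)) x := by
  have hγ' : (0 : ℝ) < γ := by positivity
  have hσ' : (0 : ℝ) < σ := by positivity
  simp only [jointPDF, gaussianPDFReal]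
  rw [mul_mul_mul_comm, mul_mul_mul_comm (√(2 * Real.pi * ↑(γ + σ)))⁻¹, ← Real.exp_add, ← Real.exp_add, ← mul_inv, ← mul_inv,
    ← Real.sqrt_mul (by positivity), ← Real.sqrt_mul (by positivity)]
  congr 1
  · congr 2
    push_cast
    field_simp
  · congr 1
    push_cast
    field_simp
    ring

theorem marginal₁_jointPDF {γ σ : ℝ≥0} (hσ : σ ≠ 0) :
    marginal₁ (jointPDF γ σ) = gaussianPDFReal 0 γ := by
  funext x
  simp only [marginal₁, jointPDF]
  rw [integral_const_mul]
  simp_rw [gaussianPDFReal_sub]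
  rw [integral_gaussianPDFReal_eq_one _ hσ, mul_one]

theorem marginal₂_jointPDF {γ σ : ℝ≥0} (hγ : γ ≠ 0) (hσ : σ ≠ 0) :
    marginal₂ (jointPDF γ σ) = gaussianPDFReal 0 (γ + σ) := by
  funext y
  simp only [marginal₂]
  simp_rw [jointPDF_factor hγ hσ]
  rw [integral_const_mul, integral_gaussianPDFReal_eq_one _ (by positivity), mul_one]

theorem logb_jointPDF {γ σ : ℝ≥0} (hγ : γ ≠ 0) (hσ : σ ≠ 0) (x y : ℝ) :
    Real.logb 2 (jointPDF γ σ x y) = logGauss γ x + logGauss σ (y - x) := by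
  rw [jointPDF, Real.logb_mul (gaussianPDFReal_pos _ _ _ hγ).ne' (gaussianPDFReal_pos _ _ _ hσ).ne']
  rfl

theorem integrable_gaussian_mul_logGauss {v : ℝ≥0} (hv : v ≠ 0) :
    Integrable fun x => gaussianPDFReal 0 v x * logGauss v x := by
  have h := (memLp_logGauss hv).integrable (by norm_num)
  rw [gaussianReal_of_var_ne_zero _ hv, integrable_withDensity_iff_integrable_smul'
    (measurable_gaussianPDF 0 v) (by simp [gaussianPDF_lt_top])] at h
  simpa using h

theorem entropy₂_jointPDF {γ σ : ℝ≥0} (hγ : γ ≠ 0) (hσ : σ ≠ 0) :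
    entropy₂ (jointPDF γ σ) = entropy₁ (gaussianPDFReal 0 γ) + entropy₁ (gaussianPDFReal 0 σ) := by
  rw [entropy₂, entropy₁, entropy₁, ← neg_add, neg_inj]
  have hmp : MeasurePreserving (MeasurableEquiv.shearAddRight ℝ) (volume : Measure (ℝ × ℝ))
      volume := measurePreserving_prod_add volume volume
  rw [← hmp.integral_comp (MeasurableEquiv.measurableEmbedding _)]
  have e : ∀ z : ℝ × ℝ, jointPDF γ σ ((MeasurableEquiv.shearAddRight ℝ) z).1
      ((MeasurableEquiv.shearAddRight ℝ) z).2 * Real.logb 2 (jointPDF γ σ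
        ((MeasurableEquiv.shearAddRight ℝ) z).1 ((MeasurableEquiv.shearAddRight ℝ) z).2) =
      (gaussianPDFReal 0 γ z.1 * logGauss γ z.1) * gaussianPDFReal 0 σ z.2 +
        gaussianPDFReal 0 γ z.1 * (gaussianPDFReal 0 σ z.2 * logGauss σ z.2) := by
    intro z
    rw [logb_jointPDF hγ hσ]
    simp [jointPDF, MeasurableEquiv.shearAddRight, Equiv.prodShear]
    ring
  simp_rw [e]
  rw [Measure.volume_eq_prod, integral_add
    ((integrable_gaussian_mul_logGauss hγ).mul_prod (integrable_gaussianPDFReal 0 σ))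
    ((integrable_gaussianPDFReal 0 γ).mul_prod (integrable_gaussian_mul_logGauss hσ)),
    integral_prod_mul (fun x => gaussianPDFReal 0 γ x * logGauss γ x),
    integral_prod_mul (gaussianPDFReal 0 γ) (fun x => gaussianPDFReal 0 σ x * logGauss σ x),
    integral_gaussianPDFReal_eq_one _ hσ, integral_gaussianPDFReal_eq_one _ hγ, mul_one, one_mul]
  rfl

/-- The likelihood ratio `p(x, y) / (p₁(x) p₂(y))` of the density `jointPDF γ σ`. -/
def likeRatio (γ σ : ℝ≥0) (x y : ℝ) : ℝ :=
  jointPDF γ σ x y / (gaussianPDFReal 0 γ x * gaussianPDFReal 0 (γ + σ) y)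

theorem measurable_likeRatio (γ σ : ℝ≥0) :
    Measurable fun z : ℝ × ℝ => likeRatio γ σ z.1 z.2 := by
  unfold likeRatio jointPDF
  fun_prop

theorem likeRatio_pos {γ σ : ℝ≥0} (hγ : γ ≠ 0) (hσ : σ ≠ 0) (x y : ℝ) :
    0 < likeRatio γ σ x y :=
  div_pos (mul_pos (gaussianPDFReal_pos _ _ _ hγ) (gaussianPDFReal_pos _ _ _ hσ))
    (mul_pos (gaussianPDFReal_pos _ _ _ hγ) (gaussianPDFReal_pos _ _ _ (by positivity)))

theorem logb_likeRatio {γ σ : ℝ≥0} (hγ : γ ≠ 0) (hσ : σ ≠ 0) (x y : ℝ) :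
    Real.logb 2 (likeRatio γ σ x y) =
      Real.logb 2 (jointPDF γ σ x y) - logGauss γ x - logGauss (γ + σ) y := by
  have h₁ := (gaussianPDFReal_pos 0 γ x hγ).ne'
  have h₂ := (gaussianPDFReal_pos 0 (γ + σ) y (by positivity)).ne'
  have h₃ : jointPDF γ σ x y ≠ 0 := mul_ne_zero h₁ (gaussianPDFReal_pos _ _ _ hσ).ne'
  rw [likeRatio, Real.logb_div h₃ (mul_ne_zero h₁ h₂), Real.logb_mul h₁ h₂, ← sub_sub]
  rfl

theorem lintegral_likeRatio {γ σ : ℝ≥0} (hγ : γ ≠ 0) (hσ : σ ≠ 0) (y : ℝ) :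
    ∫⁻ x, ENNReal.ofReal (likeRatio γ σ x y) ∂gaussianReal 0 γ = 1 := by
  rw [gaussianReal_of_var_ne_zero _ hγ, lintegral_withDensity_eq_lintegral_mul _
    (measurable_gaussianPDF 0 γ) (g := fun x => ENNReal.ofReal (likeRatio γ σ x y))
    ((measurable_likeRatio γ σ).comp (measurable_id.prodMk measurable_const)).ennreal_ofReal,
    ← lintegral_gaussianPDFReal_eq_one (y * (γ / (γ + σ))) (v := γ * σ / (γ + σ)) (by positivity)]
  refine lintegral_congr fun x => ?_
  have h₁ := (gaussianPDFReal_pos 0 γ x hγ).ne'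
  have h₂ := (gaussianPDFReal_pos 0 (γ + σ) y (by positivity)).ne'
  simp only [Pi.mul_apply, gaussianPDF]
  rw [← ENNReal.ofReal_mul (gaussianPDFReal_nonneg _ _ _), likeRatio, jointPDF_factor hγ hσ]
  congr 1
  field_simp

section Probability

variable {Ω : Type*} [MeasurableSpace Ω] {Pr : Measure Ω}

/-- Chebyshev's inequality for a sum of pairwise independent variables of equal mean. -/
theorem measure_sum_deviation_le [IsProbabilityMeasure Pr] {ι : Type*} (S : Finset ι)
    {X : ι → Ω → ℝ} (hX : ∀ t ∈ S, MemLp (X t) 2 Pr)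
    (hind : Set.Pairwise (S : Set ι) fun s t => IndepFun (X s) (X t) Pr) {m V : ℝ}
    (hm : ∀ t ∈ S, ∫ ω, X t ω ∂Pr = m) (hV : ∀ t ∈ S, variance (X t) Pr ≤ V) {c : ℝ}
    (hc : 0 < c) :
    Pr {ω | c ≤ |∑ t ∈ S, X t ω - S.card * m|} ≤ ENNReal.ofReal (S.card * V / c ^ 2) := by
  have h := meas_ge_le_variance_div_sq (memLp_finsetSum' S hX) hc
  rw [IndepFun.variance_sum hX hind] at h
  have he : ∫ ω, (∑ t ∈ S, X t) ω ∂Pr = S.card * m := by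
    simp_rw [Finset.sum_apply]
    rw [integral_finsetSum _ fun t ht => (hX t ht).integrable (by norm_num),
      Finset.sum_congr rfl hm]
    simp
  simp_rw [he, Finset.sum_apply] at h
  refine h.trans (ENNReal.ofReal_le_ofReal ?_)
  gcongr
  calc _ ≤ ∑ _t ∈ S, V := Finset.sum_le_sum hV
    _ = _ := by simp

/-- Weak law of large numbers for the empirical entropy of Gaussian samples. -/
theorem measure_logGauss_deviation_le [IsProbabilityMeasure Pr] {S : Finset ℕ} (hS : S.Nonempty)
    {Z : ℕ → Ω → ℝ} {v : ℝ≥0} (hv : v ≠ 0) (hZ : ∀ t ∈ S, HasLaw (Z t) (gaussianReal 0 v) Pr)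
    (hind : Set.Pairwise (S : Set ℕ) fun s t => IndepFun (Z s) (Z t) Pr) {ε : ℝ} (hε : 0 < ε) :
    Pr {ω | ε ≤ |(∑ t ∈ S, logGauss v (Z t ω)) / S.card + entropy₁ (gaussianPDFReal 0 v)|} ≤
      ENNReal.ofReal (variance (logGauss v) (gaussianReal 0 v) / (S.card * ε ^ 2)) := by
  have hc : (0 : ℝ) < S.card := by exact_mod_cast hS.card_pos
  have hmem := memLp_logGauss hv
  have h := measure_sum_deviation_le (Pr := Pr) S (X := fun t ω => logGauss v (Z t ω))
    (m := -entropy₁ (gaussianPDFReal 0 v)) (V := variance (logGauss v) (gaussianReal 0 v))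
    (c := S.card * ε) ?_ ?_ ?_ ?_ (by positivity)
  · refine (measure_mono fun ω hω => ?_).trans (h.trans_eq ?_)
    · simp only [Set.mem_ofPred_eq] at hω ⊢
      have : ∑ t ∈ S, logGauss v (Z t ω) - S.card * -entropy₁ (gaussianPDFReal 0 v) =
          S.card * ((∑ t ∈ S, logGauss v (Z t ω)) / S.card + entropy₁ (gaussianPDFReal 0 v)) := by
        field_simp
        ring
      rw [this, abs_mul, abs_of_pos hc]
      exact mul_le_mul_of_nonneg_left hω hc.le
    · congr 1
      field_simp
  · intro t ht
    have h1 := hmem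
    rw [← (hZ t ht).map_eq] at h1
    exact h1.comp_of_map (hZ t ht).aemeasurable
  · intro s hs t ht hst
    exact (hind hs ht hst).comp (measurable_logGauss v) (measurable_logGauss v)
  · intro t ht
    rw [← integral_logGauss_eq_neg_entropy hv]
    exact (hZ t ht).integral_comp hmem.aestronglyMeasurable
  · intro t ht
    have h1 := hmem.aestronglyMeasurable.aemeasurable
    have h2 := (hZ t ht).map_eq
    rw [← h2, variance_map (by rwa [h2]) (hZ t ht).aemeasurable]
    rfl

theorem iIndepFun_of_measurePreserving {Ω' ι : Type*} [MeasurableSpace Ω'] {Q : Measure Ω'}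
    {β : ι → Type*} [∀ k, MeasurableSpace (β k)] {X : (k : ι) → Ω' → β k} (h : iIndepFun X Q)
    (hX : ∀ k, Measurable (X k)) {g : Ω → Ω'} (hg : MeasurePreserving g Pr Q) :
    iIndepFun (fun k ω => X k (g ω)) Pr := by
  rw [iIndepFun_iff_measure_inter_preimage_eq_mul] at h ⊢
  intro S sets hsets
  have h1 := h S hsets
  have e : ∀ k ∈ S, Pr ((fun ω => X k (g ω)) ⁻¹' sets k) = Q (X k ⁻¹' sets k) := fun k hk =>
    hg.measure_preimage ((hX k) (hsets k hk)).nullMeasurableSet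
  rw [Finset.prod_congr rfl e, ← h1, ← hg.measure_preimage
    (S.measurableSet_biInter fun k hk => (hX k) (hsets k hk)).nullMeasurableSet]
  simp [Set.preimage_iInter, Set.preimage_preimage]

/-- Independent families on two probability spaces form a single independent family on the
product space. -/
theorem iIndepFun_sumElim {Ω' ι κ β : Type*} [MeasurableSpace Ω'] [MeasurableSpace β]
    {Q : Measure Ω'} [IsProbabilityMeasure Pr] [IsProbabilityMeasure Q]
    {X : ι → Ω → β} {Y : κ → Ω' → β} (hX : iIndepFun X Pr) (hY : iIndepFun Y Q) :
    iIndepFun (Sum.elim (fun k (ω : Ω × Ω') => X k ω.1) (fun k (ω : Ω × Ω') => Y k ω.2))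
      (Pr.prod Q) := by
  rw [iIndepFun_iff_measure_inter_preimage_eq_mul] at hX hY ⊢
  intro S sets hsets
  have e : (⋂ i ∈ S, Sum.elim (fun k (ω : Ω × Ω') => X k ω.1)
      (fun k (ω : Ω × Ω') => Y k ω.2) i ⁻¹' sets i) =
      (⋂ k ∈ S.toLeft, X k ⁻¹' sets (.inl k)) ×ˢ (⋂ k ∈ S.toRight, Y k ⁻¹' sets (.inr k)) := by
    ext ω
    simp [Set.mem_iInter, Sum.forall]
  have e₁ : ∀ k, Pr.prod Q ((fun ω : Ω × Ω' => X k ω.1) ⁻¹' sets (.inl k)) =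
      Pr (X k ⁻¹' sets (.inl k)) := fun k => by
    have : (fun ω : Ω × Ω' => X k ω.1) ⁻¹' sets (.inl k) =
      (X k ⁻¹' sets (.inl k)) ×ˢ Set.univ := by ext; simp
    rw [this, Measure.prod_prod, measure_univ, mul_one]
  have e₂ : ∀ k, Pr.prod Q ((fun ω : Ω × Ω' => Y k ω.2) ⁻¹' sets (.inr k)) =
      Q (Y k ⁻¹' sets (.inr k)) := fun k => by
    have : (fun ω : Ω × Ω' => Y k ω.2) ⁻¹' sets (.inr k) =
      Set.univ ×ˢ (Y k ⁻¹' sets (.inr k)) := by ext; simp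
    rw [this, Measure.prod_prod, measure_univ, one_mul]
  rw [e, Measure.prod_prod, hX _ (fun k hk => hsets _ (Finset.mem_toLeft.1 hk)),
    hY _ (fun k hk => hsets _ (Finset.mem_toRight.1 hk)),
    ← Finset.toLeft_disjSum_toRight (u := S), Finset.prod_disjSum]
  simp [e₁, e₂]

/-- The σ-algebra generated by the members of a family of random variables with index in `S`. -/
@[reducible] def sigmaOf {Ω κ : Type*} (f : κ → Ω → ℝ) (S : Set κ) : MeasurableSpace Ω :=
  ⨆ k ∈ S, MeasurableSpace.comap (f k) inferInstance

theorem measurable_sigmaOf {Ω κ : Type*} (f : κ → Ω → ℝ) {S : Set κ} {k : κ} (hk : k ∈ S) :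
    Measurable[sigmaOf f S] (f k) := by
  refine Measurable.mono (comap_measurable (f k)) ?_ le_rfl
  exact le_iSup₂_of_le k hk le_rfl

theorem indepFun_of_disjoint {κ β β' : Type*} [MeasurableSpace β] [MeasurableSpace β']
    {f : κ → Ω → ℝ} (hf : iIndepFun f Pr) (hm : ∀ k, Measurable (f k)) {S T : Set κ}
    (hST : Disjoint S T) {X : Ω → β} {Y : Ω → β'} (hX : Measurable[sigmaOf f S] X)
    (hY : Measurable[sigmaOf f T] Y) : IndepFun X Y Pr := by
  rw [IndepFun_iff_Indep]
  exact indep_of_indep_of_le (indep_iSup_of_disjoint (fun k => (hm k).comap_le) hf.iIndep hST)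
    hX.comap_le hY.comap_le

/-- If the slices of `E` only depend on a discrete function of the first coordinate and are small
for all first coordinates outside of `B`, then `E` has small measure. -/
theorem prod_measure_le_of_slices {A ι : Type*} [MeasurableSpace A] [Countable ι]
    [MeasurableSpace ι] [MeasurableSingletonClass ι] {Q : Measure A} [IsProbabilityMeasure Q]
    [IsProbabilityMeasure Pr] {f : A → ι} (hf : Measurable f) {E : Set (A × Ω)}
    (hE : ∀ a a' ω, f a = f a' → (a, ω) ∈ E → (a', ω) ∈ E) {B : Set A} {b : ℝ≥0∞}
    (hb : ∀ a ∉ B, Pr {ω | (a, ω) ∈ E} ≤ b) :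
    Q.prod Pr E ≤ Q B + b := by
  set D : ι → Set Ω := fun k => {ω | ∃ a ∉ B, f a = k ∧ (a, ω) ∈ E} with hD
  have hDb : ∀ k, Pr (D k) ≤ b := by
    intro k
    by_cases hk : ∃ a ∉ B, f a = k
    · obtain ⟨a, ha, rfl⟩ := hk
      refine (measure_mono fun ω hω => ?_).trans (hb a ha)
      obtain ⟨a', -, h, hω⟩ := hω
      exact hE a' a ω h hω
    · have : D k = ∅ := by
        ext ω
        simp only [hD, Set.mem_ofPred_eq, Set.mem_empty_iff_false, iff_false]
        rintro ⟨a, ha, hak, -⟩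
        exact hk ⟨a, ha, hak⟩
      simp [this]
  have hsub : E ⊆ (B ×ˢ Set.univ) ∪ ⋃ k, (f ⁻¹' {k}) ×ˢ D k := by
    rintro ⟨a, ω⟩ h
    by_cases ha : a ∈ B
    · exact Or.inl ⟨ha, trivial⟩
    · exact Or.inr (Set.mem_iUnion.2 ⟨f a, Set.mk_mem_prod rfl ⟨a, ha, rfl, h⟩⟩)
  have hsum : ∑' k, Q (f ⁻¹' {k}) = 1 := by
    rw [← measure_iUnion (fun k l hkl => Set.disjoint_left.2 fun a ha ha' => hkl (ha.symm.trans ha'))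
      fun k => hf (measurableSet_singleton k), ← measure_univ (μ := Q)]
    congr 1
    ext a
    simp
  calc Q.prod Pr E ≤ Q.prod Pr (B ×ˢ Set.univ) + ∑' k, Q.prod Pr ((f ⁻¹' {k}) ×ˢ D k) :=
        (measure_mono hsub).trans ((measure_union_le _ _).trans (by gcongr; exact measure_iUnion_le _))
    _ ≤ Q B + ∑' k, Q (f ⁻¹' {k}) * b := by
        simp_rw [Measure.prod_prod, measure_univ, mul_one]
        gcongr with k
        exact hDb k
    _ = Q B + b := by rw [ENNReal.tsum_mul_right, hsum, one_mul]

end Probability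

namespace Params

variable (P : Params)

/-- The randomness other than the arrivals: codebooks, preambles and noise. -/
abbrev Rest (n : ℕ) : Type := P.Codebooks n × P.Preambles n × Noise

/-- The joint law of codebooks, preambles and noise. -/
def restLaw (n : ℕ) : Measure (P.Rest n) :=
  (P.codebookLaw n).prod ((P.preambleLaw n).prod noiseLaw)

/-- Indices of the independent Gaussian variables: codebook symbols, preamble symbols, noise. -/
abbrev Coord (n : ℕ) : Type :=
  (Σ i : Fin 2, P.Msg n i × Fin (P.len n i)) ⊕ ((Fin 2 × Fin (P.preLen n)) ⊕ (Fin 2 × ℕ))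

variable {P}

/-- The Gaussian variable with a given index. -/
def coord {n : ℕ} (k : P.Coord n) (r : P.Rest n) : ℝ :=
  Sum.elim (fun (p : Σ i : Fin 2, P.Msg n i × Fin (P.len n i)) (r : P.Rest n) =>
      r.1 p.1 p.2.1 p.2.2)
    (fun q (r : P.Rest n) => Sum.elim
      (fun (p : Fin 2 × Fin (P.preLen n)) (r : P.Preambles n × Noise) => r.1 p.1 p.2)
      (fun (p : Fin 2 × ℕ) (r : P.Preambles n × Noise) => r.2 p.1 p.2) q r.2) k r

/-- The variance of the Gaussian variable with a given index. -/
def coordVar {n : ℕ} : P.Coord n → ℝ≥0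
  | .inl p => P.γ p.1
  | .inr (.inl p) => P.γ p.1
  | .inr (.inr _) => 1

instance : IsProbabilityMeasure P.arrivalLaw := by unfold arrivalLaw; infer_instance

instance (n : ℕ) : IsProbabilityMeasure (P.codebookLaw n) := by unfold codebookLaw; infer_instance

instance (n : ℕ) : IsProbabilityMeasure (P.preambleLaw n) := by unfold preambleLaw; infer_instance

instance : IsProbabilityMeasure noiseLaw := by unfold noiseLaw; infer_instance

instance (n : ℕ) : IsProbabilityMeasure (P.restLaw n) := by unfold restLaw; infer_instance

theorem measurable_coord {n : ℕ} (k : P.Coord n) : Measurable (coord k) := by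
  rcases k with ⟨i, m, l⟩ | ⟨i, l⟩ | ⟨i, t⟩
  · exact (measurable_pi_apply l).comp ((measurable_pi_apply m).comp
      ((measurable_pi_apply i).comp measurable_fst))
  · exact (measurable_pi_apply l).comp ((measurable_pi_apply i).comp
      (measurable_fst.comp measurable_snd))
  · exact (measurable_pi_apply t).comp ((measurable_pi_apply i).comp
      (measurable_snd.comp measurable_snd))

theorem hasLaw_coord {n : ℕ} (k : P.Coord n) :
    HasLaw (coord k) (gaussianReal 0 (coordVar k)) (P.restLaw n) := by
  rcases k with ⟨i, m, l⟩ | ⟨i, l⟩ | ⟨i, t⟩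
  · have h := (measurePreserving_eval (fun _ : Fin (P.len n i) => gaussianReal 0 (P.γ i)) l).comp
      ((measurePreserving_eval (fun _ : P.Msg n i => Measure.pi fun _ : Fin (P.len n i) =>
        gaussianReal 0 (P.γ i)) m).comp ((measurePreserving_eval (fun i : Fin 2 => Measure.pi
        fun _ : P.Msg n i => Measure.pi fun _ : Fin (P.len n i) => gaussianReal 0 (P.γ i)) i).comp
        (measurePreserving_fst (μ := P.codebookLaw n) (ν := (P.preambleLaw n).prod noiseLaw))))
    exact h.hasLaw
  · have h := (measurePreserving_eval (fun _ : Fin (P.preLen n) => gaussianReal 0 (P.γ i)) l).comp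
      ((measurePreserving_eval (fun i : Fin 2 => Measure.pi fun _ : Fin (P.preLen n) =>
        gaussianReal 0 (P.γ i)) i).comp ((measurePreserving_fst (μ := P.preambleLaw n)
        (ν := noiseLaw)).comp
        (measurePreserving_snd (μ := P.codebookLaw n) (ν := (P.preambleLaw n).prod noiseLaw))))
    exact h.hasLaw
  · have h := (measurePreserving_eval_infinitePi (fun _ : ℕ => gaussianReal 0 1) t).comp
      ((measurePreserving_eval (fun _ : Fin 2 => Measure.infinitePi fun _ : ℕ =>
        gaussianReal 0 1) i).comp ((measurePreserving_snd (μ := P.preambleLaw n)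
        (ν := noiseLaw)).comp
        (measurePreserving_snd (μ := P.codebookLaw n) (ν := (P.preambleLaw n).prod noiseLaw))))
    exact h.hasLaw

theorem iIndepFun_coord (n : ℕ) : iIndepFun (coord (P := P) (n := n)) (P.restLaw n) := by
  have hc : iIndepFun (fun (p : Σ i : Fin 2, P.Msg n i × Fin (P.len n i)) (c : P.Codebooks n) =>
      c p.1 p.2.1 p.2.2) (P.codebookLaw n) := by
    refine iIndepFun_uncurry (X := fun i (p : P.Msg n i × Fin (P.len n i)) (c : P.Codebooks n) =>
      c i p.1 p.2) (fun i p => by fun_prop) ?_ fun i => ?_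
    · exact iIndepFun_pi (X := fun i (c : P.Msg n i → Fin (P.len n i) → ℝ)
        (p : P.Msg n i × Fin (P.len n i)) => c p.1 p.2) fun i =>
          (measurable_pi_lambda _ fun p => by fun_prop).aemeasurable
    · refine iIndepFun_of_measurePreserving
        (X := fun (p : P.Msg n i × Fin (P.len n i)) (c : P.Msg n i → Fin (P.len n i) → ℝ) =>
          c p.1 p.2) ?_ (fun p => by fun_prop)
        (measurePreserving_eval (fun i : Fin 2 => Measure.pi
        fun _ : P.Msg n i => Measure.pi fun _ : Fin (P.len n i) => gaussianReal 0 (P.γ i)) i)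
      have h := iIndepFun_uncurry_infinitePi' (Ω := fun (_ : P.Msg n i) (_ : Fin (P.len n i)) => ℝ)
        (X := fun _ _ => id) (fun _ _ => gaussianReal 0 (P.γ i)) (fun _ _ => measurable_id)
      simp_rw [Measure.infinitePi_eq_pi] at h
      exact h
  have hp : iIndepFun (fun (p : Fin 2 × Fin (P.preLen n)) (c : P.Preambles n) => c p.1 p.2)
      (P.preambleLaw n) := by
    have h := iIndepFun_uncurry_infinitePi' (Ω := fun (_ : Fin 2) (_ : Fin (P.preLen n)) => ℝ)
      (X := fun _ _ => id) (fun i _ => gaussianReal 0 (P.γ i)) (fun _ _ => measurable_id)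
    simp_rw [Measure.infinitePi_eq_pi] at h
    exact h
  have hz : iIndepFun (fun (p : Fin 2 × ℕ) (c : Noise) => c p.1 p.2) noiseLaw := by
    have h := iIndepFun_uncurry_infinitePi' (Ω := fun (_ : Fin 2) (_ : ℕ) => ℝ)
      (X := fun _ _ => id) (fun _ _ => gaussianReal 0 1) (fun _ _ => measurable_id)
    rw [Measure.infinitePi_eq_pi] at h
    exact h
  have h := iIndepFun_sumElim hc (iIndepFun_sumElim hp hz)
  refine (iIndepFun_congr fun k => Eventually.of_forall fun r => ?_).1 h
  rcases k with k | k <;> rfl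

end Params

namespace Params

variable (P : Params)

theorem measurable_sInf_nat {A : Type*} [MeasurableSpace A] {p : ℕ → A → Prop}
    (hp : ∀ t, MeasurableSet {a | p t a}) : Measurable fun a => sInf {t : ℕ | p t a} := by
  refine measurable_to_countable' fun k => ?_
  have : (fun a => sInf {t : ℕ | p t a}) ⁻¹' {k} =
      ({a | p k a} ∩ ⋂ m ∈ Finset.range k, {a | p m a}ᶜ) ∪
        ({a | k = 0} ∩ ⋂ m, {a | p m a}ᶜ) := by
    ext a
    simp only [Set.mem_preimage, Set.mem_singleton_iff, Set.mem_union, Set.mem_inter_iff,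
      Set.mem_iInter, Set.mem_compl_iff, Set.mem_ofPred_eq, Finset.mem_range]
    constructor
    · rintro rfl
      by_cases h : {t : ℕ | p t a}.Nonempty
      · exact Or.inl ⟨Nat.sInf_mem h, fun m hm => Nat.notMem_of_lt_sInf hm⟩
      · rw [Set.not_nonempty_iff_eq_empty] at h
        refine Or.inr ⟨by simp [h], fun m hm => ?_⟩
        exact (h ▸ (hm : m ∈ {t : ℕ | p t a}) : m ∈ (∅ : Set ℕ))
    · rintro (⟨h, h'⟩ | ⟨rfl, h⟩)
      · refine le_antisymm (Nat.sInf_le h) (not_lt.1 fun hlt => ?_)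
        exact h' _ hlt (Nat.sInf_mem (s := {t : ℕ | p t a}) ⟨k, h⟩)
      · have : {t : ℕ | p t a} = ∅ := Set.eq_empty_of_forall_notMem h
        simp [this]
  rw [this]
  refine ((hp k).inter (Finset.measurableSet_biInter _ fun m _ => (hp m).compl)).union
    ((MeasurableSet.const _).inter (MeasurableSet.iInter fun m => (hp m).compl))

/-- Number of arrivals of a stream `a` of user `i` by the end of slot `t`. -/
def arrivals (n : ℕ) (i : Fin 2) (a : ℕ → Bool) (t : ℕ) : ℕ :=
  ((Finset.Icc (P.start n i) t).filter fun s => a s = true).card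

theorem arrivals_mono (n : ℕ) (i : Fin 2) (a : ℕ → Bool) : Monotone (P.arrivals n i a) :=
  fun _ _ h => Finset.card_le_card
    (Finset.filter_subset_filter _ (Finset.Icc_subset_Icc_right h))

theorem measurable_arrivals (n : ℕ) (i : Fin 2) (t : ℕ) :
    Measurable fun a => P.arrivals n i a t := by
  simp only [arrivals, Finset.card_filter]
  refine Finset.measurable_sum _ fun s _ => ?_
  exact (measurable_of_countable fun b : Bool => if b = true then 1 else 0).comp
    (measurable_pi_apply s)

theorem measurable_schedTime (n : ℕ) (i : Fin 2) (j : ℕ) :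
    Measurable fun a => P.schedTime n i a j := by
  induction j with
  | zero => exact measurable_const
  | succ j ih =>
    simp only [schedTime]
    refine measurable_sInf_nat fun t => MeasurableSet.inter ?_ ?_
    · by_cases hj : j = 0
      · simp only [hj, if_true]
        exact MeasurableSet.const _
      · simp only [hj, if_false]
        exact measurableSet_le ((ih.add measurable_const).add measurable_const) measurable_const
    · exact measurableSet_le measurable_const
        ((measurable_const.min (P.measurable_arrivals n i t)).const_mul _)

theorem k_pos' (i : Fin 2) : (0 : ℝ) < P.k i := by exact_mod_cast P.k_pos i
theorem N_pos' (i : Fin 2) : (0 : ℝ) < P.N i := by exact_mod_cast P.N_pos i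
theorem q_pos' (i : Fin 2) : (0 : ℝ) < P.q i := P.q_pos i
theorem η_pos (i : Fin 2) : 0 < P.η i := div_pos (P.k_pos' i) (P.N_pos' i)
theorem rate_pos (i : Fin 2) : 0 < P.rate i := mul_pos (P.k_pos' i) (P.q_pos' i)
theorem μ_pos (i : Fin 2) : 0 < P.μ i := div_pos (P.η_pos i) (P.rate_pos i)

theorem μ_mul_rate (i : Fin 2) : P.μ i * ((P.k i : ℝ) * P.q i) = P.η i :=
  div_mul_cancel₀ _ (P.rate_pos i).ne'

theorem tendsto_measure_arrivals_deviation (i : Fin 2) (c : ℝ) {η : ℝ} (hη : 0 < η) :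
    Tendsto (fun n : ℕ => P.arrivalLaw {α | η * n ≤
      |(P.arrivals n i (α i) (P.start n i + ⌊n * c⌋₊) : ℝ) - (⌊n * c⌋₊ + 1) * P.q i|})
      atTop (𝓝 0) := by
  set X : ℕ → Arrivals → ℝ := fun s α => if α i s = true then 1 else 0 with hX
  have hXm : ∀ s, Measurable (X s) := fun s =>
    (measurable_of_countable fun b : Bool => if b = true then (1 : ℝ) else 0).comp
      ((measurable_pi_apply s).comp (measurable_pi_apply i))
  have hX0 : ∀ s α, X s α ∈ Set.Icc (0 : ℝ) 1 := fun s α => by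
    simp only [hX]
    split_ifs <;> simp
  have hev := measurePreserving_eval (fun i : Fin 2 => Measure.infinitePi fun _ : ℕ =>
    bernoulliMeasure true false (P.q i)) i
  have hind : iIndepFun X P.arrivalLaw := by
    refine iIndepFun_of_measurePreserving (X := fun s (a : ℕ → Bool) =>
      if a s = true then (1 : ℝ) else 0) ?_ (fun s => ?_) hev
    · exact iIndepFun_infinitePi (X := fun _ b => if b = true then (1 : ℝ) else 0)
        fun _ => measurable_of_countable _
    · exact (measurable_of_countable fun b : Bool => if b = true then (1 : ℝ) else 0).comp
        (measurable_pi_apply s)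
  have hmean : ∀ s, ∫ α, X s α ∂P.arrivalLaw = P.q i := fun s => by
    have hs := ((measurePreserving_eval_infinitePi
      (fun _ : ℕ => bernoulliMeasure true false (P.q i)) s).comp hev).hasLaw
    have := hs.integral_comp (f := fun b : Bool => if b = true then (1 : ℝ) else 0)
      (measurable_of_countable _).aestronglyMeasurable
    rw [integral_bernoulliMeasure] at this
    simp only [smul_eq_mul, if_true, Bool.false_eq_true, if_false, mul_one, mul_zero,
      add_zero] at this
    exact this
  have hbound : ∀ n : ℕ, 0 < n → P.arrivalLaw {α | η * n ≤
      |(P.arrivals n i (α i) (P.start n i + ⌊n * c⌋₊) : ℝ) - (⌊n * c⌋₊ + 1) * P.q i|} ≤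
      ENNReal.ofReal ((⌊n * c⌋₊ + 1) * 1 / (η * n) ^ 2) := by
    intro n hn
    have hn' : (0 : ℝ) < n := by exact_mod_cast hn
    have h := measure_sum_deviation_le (Pr := P.arrivalLaw)
      (Finset.Icc (P.start n i) (P.start n i + ⌊n * c⌋₊)) (X := X) (m := P.q i) (V := 1)
      (c := η * n) (fun t _ => ?_) (fun s _ t _ hst => hind.indepFun hst) (fun t _ => hmean t)
      (fun t _ => ?_) (by positivity)
    · have hcard : ((Finset.Icc (P.start n i) (P.start n i + ⌊n * c⌋₊)).card : ℝ) =
          ⌊n * c⌋₊ + 1 := by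
        rw [Nat.card_Icc]
        have : P.start n i + ⌊n * c⌋₊ + 1 - P.start n i = ⌊n * c⌋₊ + 1 := by omega
        rw [this]
        push_cast
        rfl
      rw [hcard] at h
      refine le_trans (le_of_eq ?_) h
      congr 1
      ext α
      simp only [arrivals, hX, Finset.sum_boole, Set.mem_ofPred_eq]
    · exact MemLp.of_bound (hXm t).aestronglyMeasurable 1 (Eventually.of_forall fun α => by
        rw [Real.norm_eq_abs, abs_of_nonneg (hX0 t α).1]
        exact (hX0 t α).2)
    · refine (variance_le_sq_of_bounded (Eventually.of_forall fun α => hX0 t α)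
        (hXm t).aemeasurable).trans ?_
      norm_num
  have hlim : Tendsto (fun n : ℕ => ((|c| * n + 1) * 1 / (η * n) ^ 2 : ℝ)) atTop (𝓝 0) := by
    have h1 : Tendsto (fun n : ℕ => (n : ℝ)⁻¹) atTop (𝓝 0) := tendsto_inv_atTop_nhds_zero_nat
    have h2 : Tendsto (fun n : ℕ => (|c| / η ^ 2) * (n : ℝ)⁻¹ +
        (1 / η ^ 2) * ((n : ℝ)⁻¹ * (n : ℝ)⁻¹)) atTop (𝓝 0) := by
      have := (h1.const_mul (|c| / η ^ 2)).add ((h1.mul h1).const_mul (1 / η ^ 2))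
      rwa [mul_zero, mul_zero, mul_zero, add_zero] at this
    refine h2.congr' ?_
    filter_upwards [eventually_gt_atTop 0] with n hn
    have hn' : (n : ℝ) ≠ 0 := by positivity
    field_simp
  have hlim' := ENNReal.tendsto_ofReal hlim
  rw [ENNReal.ofReal_zero] at hlim'
  refine tendsto_of_tendsto_of_tendsto_of_le_of_le' tendsto_const_nhds hlim'
    (Eventually.of_forall fun _ => zero_le) ?_
  filter_upwards [eventually_gt_atTop 0] with n hn
  refine (hbound n hn).trans (ENNReal.ofReal_le_ofReal ?_)
  have : (⌊n * c⌋₊ : ℝ) ≤ |c| * n := by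
    rcases le_total 0 c with h | h
    · rw [abs_of_nonneg h, mul_comm]
      exact Nat.floor_le (by positivity)
    · rw [Nat.floor_of_nonpos (mul_nonpos_of_nonneg_of_nonpos (by positivity) h)]
      simp only [Nat.cast_zero]
      positivity
  gcongr

/-- All bursts start approximately when expected. -/
def Concentrated (n : ℕ) (δ : ℝ) (α : Arrivals) : Prop :=
  ∀ i, ∀ j ∈ Finset.Icc 1 (P.N i),
    |(P.schedTime n i (α i) j : ℝ) - n * (P.ν i + j * P.μ i)| ≤ δ * n

theorem bits_le (n : ℕ) (i : Fin 2) : (P.bits n i : ℝ) ≤ n * P.η i :=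
  Nat.floor_le (mul_nonneg n.cast_nonneg (P.η_pos i).le)

theorem len_le (n : ℕ) (i : Fin 2) : (P.len n i : ℝ) ≤ n * P.θ i :=
  Nat.floor_le (mul_nonneg n.cast_nonneg (P.θ_pos i).le)

theorem start_le (n : ℕ) (i : Fin 2) : (P.start n i : ℝ) ≤ n * P.ν i :=
  Nat.floor_le (mul_nonneg n.cast_nonneg (P.ν_pos i).le)

theorem mul_bits_le {n : ℕ} {i : Fin 2} {j : ℕ} (hj : j ≤ P.N i) : j * P.bits n i ≤ P.k i * n := by
  have h : (j : ℝ) * P.bits n i ≤ P.k i * n := by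
    calc (j : ℝ) * P.bits n i ≤ P.N i * (n * P.η i) := by
          have := P.bits_le n i
          gcongr
      _ = P.k i * n := by
          have := (P.N_pos' i).ne'
          rw [η]
          field_simp
  exact_mod_cast h

theorem schedTime_le {n : ℕ} {i : Fin 2} {a : ℕ → Bool} {T : ℕ → ℕ}
    (hT₁ : P.start n i ≤ T 1)
    (hT : ∀ j, 1 ≤ j → j < P.N i → T j + P.preLen n + P.len n i ≤ T (j + 1))
    (ha : ∀ j ∈ Finset.Icc 1 (P.N i), j * P.bits n i ≤ P.k i * P.arrivals n i a (T j))
    {j : ℕ} (hj : j < P.N i) :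
    P.schedTime n i a (j + 1) ≤ T (j + 1) ∧
      (j + 1) * P.bits n i ≤ P.k i * P.arrivals n i a (P.schedTime n i a (j + 1)) := by
  have key : ∀ b, b ≤ T (j + 1) → T (j + 1) ∈ {t : ℕ | b ≤ t ∧
      (j + 1) * P.bits n i ≤ P.k i * P.packets n i a t} := by
    intro b hb
    refine ⟨hb, ?_⟩
    have h1 := ha (j + 1) (Finset.mem_Icc.2 ⟨by omega, hj⟩)
    have h2 := P.mul_bits_le (n := n) (show j + 1 ≤ P.N i from hj)
    simp only [packets]
    rw [← Nat.mul_min_mul_left]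
    exact le_min h2 h1
  have hb : (if j = 0 then P.start n i else P.schedTime n i a j + P.preLen n + P.len n i) ≤
      T (j + 1) := by
    split_ifs with h
    · subst h
      exact hT₁
    · obtain ⟨l, rfl⟩ := Nat.exists_eq_succ_of_ne_zero h
      have h1 := (schedTime_le hT₁ hT ha (j := l) (by omega)).1
      have h2 := hT (l + 1) (by omega) hj
      simp only [Nat.succ_eq_add_one] at *
      omega
  have hmem := Nat.sInf_mem ⟨_, key _ hb⟩
  rw [schedTime]
  refine ⟨Nat.sInf_le (key _ hb), hmem.2.trans ?_⟩
  exact Nat.mul_le_mul_left _ (min_le_right _ _)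

theorem tendsto_measure_not_concentrated (himm : P.Immediate) {δ : ℝ} (hδ : 0 < δ) :
    Tendsto (fun n : ℕ => P.arrivalLaw {α | ¬ P.Concentrated n δ α}) atTop (𝓝 0) := by
  obtain ⟨d, hd, hdδ, hdμ⟩ : ∃ d : ℝ, 0 < d ∧ d < δ ∧ ∀ i, d < P.μ i := by
    have h : ∀ᶠ d in 𝓝[>] (0 : ℝ), 0 < d ∧ d < δ ∧ ∀ i, d < P.μ i :=
      (eventually_mem_nhdsWithin).and ((eventually_nhdsWithin_of_eventually_nhds
        (gt_mem_nhds hδ)).and (eventually_all.2 fun i =>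
          eventually_nhdsWithin_of_eventually_nhds (gt_mem_nhds (P.μ_pos i))))
    exact h.exists
  set D : ℕ → (i : Fin 2) → ℝ → Set Arrivals := fun n i c => {α | (d * P.q i / 2) * n ≤
      |(P.arrivals n i (α i) (P.start n i + ⌊n * c⌋₊) : ℝ) - (⌊n * c⌋₊ + 1) * P.q i|} with hD
  have hDlim : ∀ i c, Tendsto (fun n => P.arrivalLaw (D n i c)) atTop (𝓝 0) := fun i c =>
    P.tendsto_measure_arrivals_deviation i c (by have := P.q_pos' i; positivity)
  have hlim : Tendsto (fun n : ℕ => ∑ i, ∑ j ∈ Finset.Icc 1 (P.N i),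
      (P.arrivalLaw (D n i (j * P.μ i - d)) + P.arrivalLaw (D n i (j * P.μ i + d))))
      atTop (𝓝 0) := by
    have := tendsto_finsetSum Finset.univ fun i _ =>
      tendsto_finsetSum (Finset.Icc 1 (P.N i)) fun j _ =>
        (hDlim i (j * P.μ i - d)).add (hDlim i (j * P.μ i + d))
    simpa using this
  refine tendsto_of_tendsto_of_tendsto_of_le_of_le' tendsto_const_nhds hlim
    (Eventually.of_forall fun _ => zero_le) ?_
  have hgap : ∀ᶠ n : ℕ in atTop, ∀ i, 1 < P.N i →
      (P.preLen n : ℝ) + 2 ≤ n * (P.μ i - P.θ i) := by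
    refine eventually_all.2 fun i => ?_
    by_cases hi : 1 < P.N i
    · have hpos : 0 < P.μ i - P.θ i := sub_pos.2 (himm i hi)
      have h1 := P.preLen_isLittleO.eventually (gt_mem_nhds (half_pos hpos))
      have h2 := tendsto_natCast_atTop_atTop.eventually_ge_atTop (4 / (P.μ i - P.θ i))
      filter_upwards [h1, h2, eventually_gt_atTop 0] with n h1 h2 hn _
      have hn' : (0 : ℝ) < n := by exact_mod_cast hn
      rw [div_lt_iff₀ hn'] at h1
      rw [div_le_iff₀ hpos] at h2
      nlinarith
    · exact Eventually.of_forall fun n h => absurd h hi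
  have hbig : ∀ᶠ n : ℕ in atTop, ∀ i, ∀ j ∈ Finset.Icc 1 (P.N i),
      (j : ℝ) < P.k i * P.q i * (n * d / 2 - 1) := by
    refine eventually_all.2 fun i => (Finset.eventually_all _).2 fun j _ => ?_
    have hq := mul_pos (P.k_pos' i) (P.q_pos' i)
    have h2 := tendsto_natCast_atTop_atTop.eventually_gt_atTop
      ((j / (P.k i * P.q i : ℝ) + 1) * 2 / d)
    filter_upwards [h2] with n h2
    rw [div_lt_iff₀ hd, ← lt_div_iff₀ (by norm_num), ← lt_sub_iff_add_lt, div_lt_iff₀ hq] at h2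
    linarith
  have hδn : ∀ᶠ n : ℕ in atTop, 2 ≤ (n : ℝ) * (δ - d) := by
    have h2 := tendsto_natCast_atTop_atTop.eventually_ge_atTop (2 / (δ - d))
    filter_upwards [h2] with n h2
    rwa [div_le_iff₀ (sub_pos.2 hdδ)] at h2
  filter_upwards [hgap, hbig, hδn] with n hgap hbig hδn
  have hsub : {α | ¬ P.Concentrated n δ α} ⊆ ⋃ i, ⋃ j ∈ Finset.Icc 1 (P.N i),
      (D n i (j * P.μ i - d) ∪ D n i (j * P.μ i + d)) := by
    intro α hα
    by_contra hcon
    refine hα ?_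
    simp only [Set.mem_iUnion, not_exists, Set.mem_union, not_or, hD, Set.mem_ofPred_eq,
      not_le] at hcon
    intro i
    have hq := P.q_pos' i
    have hk := P.k_pos' i
    have hμ := P.μ_pos i
    have hμk := P.μ_mul_rate i
    set T : ℕ → ℕ := fun j => P.start n i + ⌊n * (j * P.μ i + d)⌋₊ with hT
    have hTle : ∀ j, (T j : ℝ) ≤ n * (P.ν i + j * P.μ i) + n * d := fun j => by
      have := P.start_le n i
      have := Nat.floor_le (a := (n : ℝ) * (j * P.μ i + d)) (by positivity)
      simp only [hT]
      push_cast
      linarith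
    have hTge : ∀ j, n * (P.ν i + j * P.μ i) + n * d - 2 ≤ T j := fun j => by
      have := Nat.lt_floor_add_one ((n : ℝ) * P.ν i)
      have := Nat.lt_floor_add_one ((n : ℝ) * (j * P.μ i + d))
      simp only [hT, start]
      push_cast
      linarith
    have hsep : ∀ j, 1 ≤ j → j < P.N i → T j + P.preLen n + P.len n i ≤ T (j + 1) := by
      intro j h1 hj
      have h := hgap i (by omega)
      have h2 := hTge (j + 1)
      have h3 := hTle j
      have h4 := P.len_le n i
      have : (T j + P.preLen n + P.len n i : ℝ) ≤ T (j + 1) := by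
        push_cast at h2
        linarith
      exact_mod_cast this
    have harr : ∀ j ∈ Finset.Icc 1 (P.N i),
        j * P.bits n i ≤ P.k i * P.arrivals n i (α i) (T j) := by
      intro j hj
      have h := (abs_lt.1 (hcon i j hj).2).1
      have h1 := Nat.lt_floor_add_one ((n : ℝ) * (j * P.μ i + d))
      have h2 := mul_lt_mul_of_pos_right h1 hq
      have h3 := P.bits_le n i
      have h4 : (n : ℝ) * (j * P.μ i * P.q i) + 0 ≤ P.arrivals n i (α i) (T j) := by
        simp only [hT]
        have : (0 : ℝ) ≤ n * (d * P.q i / 2) := by positivity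
        nlinarith
      have h5 : (j : ℝ) * P.bits n i ≤ P.k i * P.arrivals n i (α i) (T j) := by
        calc (j : ℝ) * P.bits n i ≤ j * (n * P.η i) := by gcongr
          _ = P.k i * (n * (j * P.μ i * P.q i) + 0) := by rw [← hμk]; ring
          _ ≤ _ := by gcongr
      exact_mod_cast h5
    intro j hj
    have hj' := Finset.mem_Icc.1 hj
    obtain ⟨l, rfl⟩ : ∃ l, j = l + 1 := ⟨j - 1, by omega⟩
    have hmain := P.schedTime_le (a := α i) (T := T) (by simp [hT]) hsep harr
      (show l < P.N i by omega)
    set τ := P.schedTime n i (α i) (l + 1)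
    have hlow : P.start n i + ⌊n * ((l + 1 : ℕ) * P.μ i - d)⌋₊ ≤ τ := by
      by_contra hlt
      have hmono := P.arrivals_mono n i (α i) (not_le.1 hlt).le
      have h := (abs_lt.1 (hcon i (l + 1) hj).1).2
      have hnn : (0 : ℝ) ≤ ((l + 1 : ℕ) : ℝ) * P.μ i - d := by
        have := hdμ i
        have : P.μ i ≤ ((l + 1 : ℕ) : ℝ) * P.μ i := le_mul_of_one_le_left hμ.le (by simp)
        linarith
      have h1 := Nat.floor_le (a := (n : ℝ) * (((l + 1 : ℕ) : ℝ) * P.μ i - d))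
        (mul_nonneg n.cast_nonneg hnn)
      have h2 := mul_le_mul_of_nonneg_right h1 hq.le
      have h3 := Nat.lt_floor_add_one ((n : ℝ) * P.η i)
      have h4 := hbig i (l + 1) hj
      have h5 : ((l + 1 : ℕ) : ℝ) * P.bits n i ≤
          P.k i * P.arrivals n i (α i) (P.start n i + ⌊n * ((l + 1 : ℕ) * P.μ i - d)⌋₊) := by
        exact_mod_cast hmain.2.trans (Nat.mul_le_mul_left _ hmono)
      have h6 : ((l + 1 : ℕ) : ℝ) * (n * P.η i - 1) ≤ ((l + 1 : ℕ) : ℝ) * P.bits n i := by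
        gcongr
        simp only [bits]
        linarith
      have h7 : (P.arrivals n i (α i) (P.start n i + ⌊n * ((l + 1 : ℕ) * P.μ i - d)⌋₊) : ℝ) ≤
          n * (((l + 1 : ℕ) : ℝ) * P.μ i) * P.q i - (n * d / 2 - 1) * P.q i := by
        nlinarith
      have h8 := mul_le_mul_of_nonneg_left h7 hk.le
      have h9 : (P.k i : ℝ) * (n * (((l + 1 : ℕ) : ℝ) * P.μ i) * P.q i -
          (n * d / 2 - 1) * P.q i) = ((l + 1 : ℕ) : ℝ) * (n * P.η i) -
          P.k i * P.q i * (n * d / 2 - 1) := by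
        rw [← hμk]
        ring
      linarith
    have hup := hTle (l + 1)
    have h1 : (τ : ℝ) ≤ T (l + 1) := by exact_mod_cast hmain.1
    have h2 : ((P.start n i + ⌊n * ((l + 1 : ℕ) * P.μ i - d)⌋₊ : ℕ) : ℝ) ≤ τ := by
      exact_mod_cast hlow
    have h3 := Nat.lt_floor_add_one ((n : ℝ) * P.ν i)
    have h4 := Nat.lt_floor_add_one ((n : ℝ) * ((l + 1 : ℕ) * P.μ i - d))
    rw [Nat.cast_add, start] at h2
    rw [abs_le]
    constructor <;> linarith
  refine (measure_mono hsub).trans ((measure_iUnion_fintype_le _ _).trans ?_)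
  refine Finset.sum_le_sum fun i _ => (measure_biUnion_finset_le _ _).trans ?_
  exact Finset.sum_le_sum fun j _ => measure_union_le _ _

end Params

namespace Params

variable (P : Params)

/-- The bursts of user `u` do not overlap. -/
def Separated (n : ℕ) (α : Arrivals) (u : Fin 2) : Prop :=
  ∀ l l', 1 ≤ l → l < l' → l' ≤ P.N u →
    P.schedTime n u (α u) l + P.preLen n + P.len n u ≤ P.schedTime n u (α u) l'

/-- All points of the scaled interference pattern that are relevant for the `j`-th codeword of
user `i` are at least `8 δ` apart. -/
structure Margin (i : Fin 2) (j : ℕ) (δ : ℝ) : Prop where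
  pos : 0 < δ
  len_le : ∀ u, 8 * δ ≤ P.θ u
  gap : ∀ u, 1 < P.N u → 8 * δ ≤ P.μ u - P.θ u
  start_start : ∀ m ∈ Finset.Icc 1 (P.N i.rev), 8 * δ ≤ |P.offset i j m|
  start_stop : ∀ m ∈ Finset.Icc 1 (P.N i.rev), 8 * δ ≤ |P.offset i j m - P.θ i|
  stop_start : ∀ m ∈ Finset.Icc 1 (P.N i.rev), 8 * δ ≤ |P.offset i j m + P.θ i.rev|
  stop_stop : ∀ m ∈ Finset.Icc 1 (P.N i.rev), 8 * δ ≤ |P.offset i j m - (P.θ i - P.θ i.rev)|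

theorem offset_ne (hres : P.NoCoincidence) (i : Fin 2) {j m : ℕ}
    (hj : j ∈ Finset.Icc 1 (P.N i)) (hm : m ∈ Finset.Icc 1 (P.N i.rev)) :
    P.offset i j m ≠ 0 ∧ P.offset i j m - P.θ i ≠ 0 ∧ P.offset i j m + P.θ i.rev ≠ 0 ∧
      P.offset i j m - (P.θ i - P.θ i.rev) ≠ 0 := by
  fin_cases i
  · have h := hres j hj m hm
    simp only [Set.mem_insert_iff, Set.mem_singleton_iff, not_or] at h
    obtain ⟨h1, h2, h3, h4⟩ := h
    refine ⟨fun h => h1 h, fun h => h2 ?_, fun h => h3 ?_, fun h => h4 ?_⟩ <;>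
    · simp only [offset] at h
      change _ = _ at h
      simp only [Fin.zero_eta, Fin.rev_zero, Fin.last, Nat.reduceAdd, Fin.mk_one] at h
      change (m : ℝ) * P.μ 1 - j * P.μ 0 + P.ν 1 - P.ν 0 = _
      linarith
  · have h := hres m hm j hj
    simp only [Set.mem_insert_iff, Set.mem_singleton_iff, not_or] at h
    obtain ⟨h1, h2, h3, h4⟩ := h
    have e : P.offset 1 j m = (m : ℝ) * P.μ 0 - j * P.μ 1 + P.ν 0 - P.ν 1 := rfl
    refine ⟨fun h => h1 ?_, fun h => h3 ?_, fun h => h2 ?_, fun h => h4 ?_⟩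
    · change P.offset 1 j m = 0 at h
      linarith
    · change P.offset 1 j m - P.θ 1 = 0 at h
      linarith
    · change P.offset 1 j m + P.θ 0 = 0 at h
      linarith
    · change P.offset 1 j m - (P.θ 1 - P.θ 0) = 0 at h
      linarith

theorem eventually_margin (himm : P.Immediate) (hres : P.NoCoincidence) (i : Fin 2) {j : ℕ}
    (hj : j ∈ Finset.Icc 1 (P.N i)) : ∀ᶠ δ in 𝓝[>] (0 : ℝ), P.Margin i j δ := by
  have key : ∀ x : ℝ, 0 < x → ∀ᶠ δ in 𝓝[>] (0 : ℝ), 8 * δ ≤ x := fun x hx => by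
    have := eventually_nhdsWithin_of_eventually_nhds (s := Set.Ioi 0)
      (gt_mem_nhds (show (0 : ℝ) < x / 8 by positivity))
    filter_upwards [this] with δ h
    linarith
  have hne := fun m (hm : m ∈ Finset.Icc 1 (P.N i.rev)) => P.offset_ne hres i hj hm
  have h1 := eventually_all.2 fun u => key _ (P.θ_pos u)
  have h2 : ∀ᶠ δ in 𝓝[>] (0 : ℝ), ∀ u, 1 < P.N u → 8 * δ ≤ P.μ u - P.θ u := by
    refine eventually_all.2 fun u => ?_
    by_cases hu : 1 < P.N u
    · exact (key _ (sub_pos.2 (himm u hu))).mono fun _ h _ => h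
    · exact Eventually.of_forall fun _ h => absurd h hu
  have h3 := (Finset.eventually_all (Finset.Icc 1 (P.N i.rev))).2 fun m hm =>
    key _ (abs_pos.2 (hne m hm).1)
  have h4 := (Finset.eventually_all (Finset.Icc 1 (P.N i.rev))).2 fun m hm =>
    key _ (abs_pos.2 (hne m hm).2.1)
  have h5 := (Finset.eventually_all (Finset.Icc 1 (P.N i.rev))).2 fun m hm =>
    key _ (abs_pos.2 (hne m hm).2.2.1)
  have h6 := (Finset.eventually_all (Finset.Icc 1 (P.N i.rev))).2 fun m hm =>
    key _ (abs_pos.2 (hne m hm).2.2.2)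
  filter_upwards [h1, h2, h3, h4, h5, h6, self_mem_nhdsWithin] with δ h1 h2 h3 h4 h5 h6 h
  exact ⟨h, h1, h2, h3, h4, h5, h6⟩

variable {P}

theorem Concentrated.separated {n : ℕ} {δ : ℝ} {α : Arrivals} (hα : P.Concentrated n δ α)
    (hn : (P.preLen n : ℝ) + 1 ≤ δ * n) {u : Fin 2}
    (hgap : 1 < P.N u → 8 * δ ≤ P.μ u - P.θ u) : P.Separated n α u := by
  intro l l' hl hll' hl'
  have h1 := abs_le.1 (hα u l (Finset.mem_Icc.2 ⟨hl, by omega⟩))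
  have h2 := abs_le.1 (hα u l' (Finset.mem_Icc.2 ⟨by omega, hl'⟩))
  have h3 := P.len_le n u
  have h4 := hgap (by omega)
  have h5 : ((l : ℝ) + 1) * P.μ u ≤ l' * P.μ u := by
    have := P.μ_pos u
    gcongr
    exact_mod_cast hll'
  have h6 := mul_le_mul_of_nonneg_left h4 (n.cast_nonneg (α := ℝ))
  have h7 := mul_le_mul_of_nonneg_left h5 (n.cast_nonneg (α := ℝ))
  have h8 : (0 : ℝ) ≤ δ * n := by
    have : (0 : ℝ) ≤ P.preLen n := Nat.cast_nonneg _
    linarith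
  have : (P.schedTime n u (α u) l + P.preLen n + P.len n u : ℝ) ≤ P.schedTime n u (α u) l' := by
    nlinarith
  exact_mod_cast this

theorem sub_ge_of_near {n : ℕ} {δ u v : ℝ} {U V : ℕ} (hU : |(U : ℝ) - n * u| ≤ 2 * δ * n)
    (hV : |(V : ℝ) - n * v| ≤ 2 * δ * n) (h : 8 * δ ≤ |v - u|) (hUV : U < V) :
    4 * δ * n ≤ (V : ℝ) - U := by
  have h1 := abs_le.1 hU
  have h2 := abs_le.1 hV
  have h3 : (U : ℝ) < V := by exact_mod_cast hUV
  rcases le_abs.1 h with h | h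
  · have := mul_le_mul_of_nonneg_left h (n.cast_nonneg (α := ℝ))
    linarith
  · have := mul_le_mul_of_nonneg_left h (n.cast_nonneg (α := ℝ))
    linarith

theorem card_ge_of_gaps {S : Finset ℕ} {A D L U : ℕ}
    (h : ∀ t, t ∈ S ↔ (A < t ∧ t ≤ D) ∧ L < t ∧ t ≤ U) (hS : S.Nonempty) {K : ℝ}
    (h1 : A < D → K ≤ (D : ℝ) - A) (h2 : A < U → K ≤ (U : ℝ) - A) (h3 : L < D → K ≤ (D : ℝ) - L)
    (h4 : L < U → K ≤ (U : ℝ) - L) : K ≤ S.card := by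
  have hS' : S = Finset.Ioc (max A L) (min D U) := by
    ext t
    rw [h, Finset.mem_Ioc]
    omega
  obtain ⟨t, ht⟩ := hS
  rw [h] at ht
  rw [hS', Nat.card_Ioc, Nat.cast_sub (by omega)]
  rcases max_cases A L with ⟨e, _⟩ | ⟨e, _⟩ <;> rcases min_cases D U with ⟨e', _⟩ | ⟨e', _⟩ <;>
    rw [e, e']
  · exact h1 (by omega)
  · exact h2 (by omega)
  · exact h3 (by omega)
  · exact h4 (by omega)

section Pattern

variable {n : ℕ} {δ : ℝ} {s : P.Sample n} {i : Fin 2} {j : ℕ}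

theorem near_start (hs : P.Concentrated n δ s.1) (hn : (P.preLen n : ℝ) + 1 ≤ δ * n) {u : Fin 2}
    {l : ℕ} (hl : l ∈ Finset.Icc 1 (P.N u)) :
    |(tau s u l : ℝ) - n * (P.ν u + l * P.μ u)| ≤ 2 * δ * n := by
  have h := hs u l hl
  have h0 : (0 : ℝ) ≤ P.preLen n := Nat.cast_nonneg _
  simp only [tau]
  linarith

theorem near_codeword (hs : P.Concentrated n δ s.1) (hn : (P.preLen n : ℝ) + 1 ≤ δ * n) {u : Fin 2}
    {l : ℕ} (hl : l ∈ Finset.Icc 1 (P.N u)) :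
    |((tau s u l + P.preLen n : ℕ) : ℝ) - n * (P.ν u + l * P.μ u)| ≤ 2 * δ * n := by
  have h := abs_le.1 (hs u l hl)
  have h0 : (0 : ℝ) ≤ P.preLen n := Nat.cast_nonneg _
  simp only [tau]
  push_cast
  rw [abs_le]
  constructor <;> linarith

theorem near_stop (hs : P.Concentrated n δ s.1) (hn : (P.preLen n : ℝ) + 1 ≤ δ * n) {u : Fin 2}
    {l : ℕ} (hl : l ∈ Finset.Icc 1 (P.N u)) :
    |((tau s u l + P.preLen n + P.len n u : ℕ) : ℝ) - n * (P.ν u + l * P.μ u + P.θ u)| ≤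
      2 * δ * n := by
  have h := abs_le.1 (hs u l hl)
  have h0 : (0 : ℝ) ≤ P.preLen n := Nat.cast_nonneg _
  have h1 := P.len_le n u
  have h2 := Nat.lt_floor_add_one ((n : ℝ) * P.θ u)
  have h3 : (P.len n u : ℝ) = ⌊(n : ℝ) * P.θ u⌋₊ := rfl
  simp only [tau]
  push_cast
  rw [abs_le]
  constructor <;> linarith

theorem mem_window {t : ℕ} : t ∈ window s i j ↔
    tau s i j + P.preLen n < t ∧ t ≤ tau s i j + P.preLen n + P.len n i := by
  rw [window, Finset.mem_Icc]
  omega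

theorem mem_interfered {m t : ℕ} : t ∈ interfered s i j m ↔
    (tau s i j + P.preLen n < t ∧ t ≤ tau s i j + P.preLen n + P.len n i) ∧
      tau s i.rev m < t ∧ t ≤ tau s i.rev m + P.preLen n + P.len n i.rev := by
  rw [interfered, Finset.mem_filter, mem_window]
  omega

theorem mem_clean {m t : ℕ} : t ∈ clean s i j m ↔
    (tau s i j + P.preLen n < t ∧ t ≤ tau s i j + P.preLen n + P.len n i) ∧
      (m = 0 ∨ tau s i.rev m + P.preLen n + P.len n i.rev < t) ∧
      (m = P.N i.rev ∨ t ≤ tau s i.rev (m + 1)) := by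
  rw [clean, Finset.mem_filter, mem_window]
  omega

theorem interfered_card_ge (hs : P.Concentrated n δ s.1) (hn : (P.preLen n : ℝ) + 1 ≤ δ * n)
    (hδ : P.Margin i j δ) (hj : j ∈ Finset.Icc 1 (P.N i)) {m : ℕ}
    (hm : m ∈ Finset.Icc 1 (P.N i.rev)) (hne : (interfered s i j m).Nonempty) :
    4 * δ * n ≤ (interfered s i j m).card := by
  have ho : P.offset i j m = m * P.μ i.rev - j * P.μ i + P.ν i.rev - P.ν i := rfl
  refine card_ge_of_gaps (fun t => mem_interfered) hne
    (sub_ge_of_near (near_codeword hs hn hj) (near_stop hs hn hj) ?_)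
    (sub_ge_of_near (near_codeword hs hn hj) (near_stop hs hn hm) ?_)
    (sub_ge_of_near (near_start hs hn hm) (near_stop hs hn hj) ?_)
    (sub_ge_of_near (near_start hs hn hm) (near_stop hs hn hm) ?_)
  · rw [add_sub_cancel_left]
    exact (hδ.len_le i).trans (le_abs_self _)
  · convert hδ.stop_start m hm using 2
    rw [ho]
    ring
  · rw [abs_sub_comm]
    convert hδ.start_stop m hm using 2
    rw [ho]
    ring
  · rw [add_sub_cancel_left]
    exact (hδ.len_le _).trans (le_abs_self _)

theorem clean_card_ge (hs : P.Concentrated n δ s.1) (hn : (P.preLen n : ℝ) + 1 ≤ δ * n)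
    (hδ : P.Margin i j δ) (hj : j ∈ Finset.Icc 1 (P.N i)) {m : ℕ} (hm : m ≤ P.N i.rev)
    (hne : (clean s i j m).Nonempty) : 4 * δ * n ≤ (clean s i j m).card := by
  have hN := P.N_pos i.rev
  have hAD : tau s i j + P.preLen n < tau s i j + P.preLen n + P.len n i →
      4 * δ * n ≤ ((tau s i j + P.preLen n + P.len n i : ℕ) : ℝ) -
        (tau s i j + P.preLen n : ℕ) := by
    refine sub_ge_of_near (near_codeword hs hn hj) (near_stop hs hn hj) ?_
    rw [add_sub_cancel_left]
    exact (hδ.len_le i).trans (le_abs_self _)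
  have hAB : m < P.N i.rev → tau s i j + P.preLen n < tau s i.rev (m + 1) →
      4 * δ * n ≤ (tau s i.rev (m + 1) : ℝ) - (tau s i j + P.preLen n : ℕ) := by
    intro h
    have hm' : m + 1 ∈ Finset.Icc 1 (P.N i.rev) := Finset.mem_Icc.2 ⟨by omega, h⟩
    refine sub_ge_of_near (near_codeword hs hn hj) (near_start hs hn hm') ?_
    convert hδ.start_start _ hm' using 2
    rw [offset]
    ring
  have hCD : m ≠ 0 → tau s i.rev m + P.preLen n + P.len n i.rev <
      tau s i j + P.preLen n + P.len n i →
      4 * δ * n ≤ ((tau s i j + P.preLen n + P.len n i : ℕ) : ℝ) -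
        (tau s i.rev m + P.preLen n + P.len n i.rev : ℕ) := by
    intro h
    have hm' : m ∈ Finset.Icc 1 (P.N i.rev) := Finset.mem_Icc.2 ⟨by omega, hm⟩
    refine sub_ge_of_near (near_stop hs hn hm') (near_stop hs hn hj) ?_
    rw [abs_sub_comm]
    convert hδ.stop_stop _ hm' using 2
    rw [offset]
    ring
  have hCB : m ≠ 0 → m < P.N i.rev → tau s i.rev m + P.preLen n + P.len n i.rev <
      tau s i.rev (m + 1) → 4 * δ * n ≤ (tau s i.rev (m + 1) : ℝ) -
        (tau s i.rev m + P.preLen n + P.len n i.rev : ℕ) := by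
    intro h h'
    refine sub_ge_of_near (near_stop hs hn (Finset.mem_Icc.2 ⟨by omega, hm⟩))
      (near_start hs hn (Finset.mem_Icc.2 ⟨by omega, h'⟩)) ?_
    refine (hδ.gap i.rev (by omega)).trans ((le_of_eq ?_).trans (le_abs_self _))
    push_cast
    ring
  rcases eq_or_ne m 0 with h0 | h0
  · refine card_ge_of_gaps (L := tau s i j + P.preLen n) (U := tau s i.rev (m + 1))
      (fun t => ?_) hne hAD (hAB (by omega)) hAD (hAB (by omega))
    rw [mem_clean]
    omega
  · rcases eq_or_ne m (P.N i.rev) with h1 | h1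
    · refine card_ge_of_gaps (L := tau s i.rev m + P.preLen n + P.len n i.rev)
        (U := tau s i j + P.preLen n + P.len n i)
        (fun t => ?_) hne hAD hAD (hCD h0) (hCD h0)
      rw [mem_clean]
      omega
    · refine card_ge_of_gaps (L := tau s i.rev m + P.preLen n + P.len n i.rev)
        (U := tau s i.rev (m + 1))
        (fun t => ?_) hne hAD (hAB (by omega)) (hCD h0) (hCB h0 (by omega))
      rw [mem_clean]
      omega

/-- The segments of a codeword form a partition of its window. -/
theorem sum_window (hsep : P.Separated n s.1 i.rev) (f : ℕ → ℝ) :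
    ∑ t ∈ window s i j, f t = ∑ m ∈ Finset.Icc 1 (P.N i.rev), ∑ t ∈ interfered s i j m, f t +
      ∑ m ∈ Finset.Icc 0 (P.N i.rev), ∑ t ∈ clean s i j m, f t := by
  simp only [interfered, clean, Finset.sum_filter]
  rw [Finset.sum_comm, Finset.sum_comm (s := Finset.Icc 0 _), ← Finset.sum_add_distrib]
  refine Finset.sum_congr rfl fun t _ => ?_
  set B := fun m => tau s i.rev m with hB
  have hsep' : ∀ l l', 1 ≤ l → l < l' → l' ≤ P.N i.rev →
    B l + P.preLen n + P.len n i.rev ≤ B l' := hsep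
  obtain ⟨k, hkN, hk⟩ : ∃ k ≤ P.N i.rev, ∀ m ∈ Finset.Icc 1 (P.N i.rev), (B m < t ↔ m ≤ k) := by
    classical
    refine ⟨Nat.findGreatest (fun m => B m < t) (P.N i.rev), Nat.findGreatest_le _,
      fun m hm => ⟨fun h => Nat.le_findGreatest (Finset.mem_Icc.1 hm).2 h, fun h => ?_⟩⟩
    have hm' := Finset.mem_Icc.1 hm
    have h1 : B (Nat.findGreatest (fun m => B m < t) (P.N i.rev)) < t :=
      Nat.findGreatest_of_ne_zero (m := Nat.findGreatest (fun m => B m < t) (P.N i.rev)) rfl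
        (by omega)
    rcases h.eq_or_lt with h | h
    · rwa [h]
    · have := hsep' m _ hm'.1 h (Nat.findGreatest_le _)
      omega
  by_cases hc : 1 ≤ k ∧ t ≤ B k + P.preLen n + P.len n i.rev
  · have h1 : ∀ m ∈ Finset.Icc 1 (P.N i.rev),
        ((B m + 1 ≤ t ∧ t ≤ B m + P.preLen n + P.len n i.rev) ↔ m = k) := by
      intro m hm
      have hm' := Finset.mem_Icc.1 hm
      have h2 := hk m hm
      constructor
      · rintro ⟨h3, h4⟩
        by_contra hne
        have := hsep' m k hm'.1 (by omega) hkN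
        have := (hk k (Finset.mem_Icc.2 ⟨hc.1, hkN⟩)).2 le_rfl
        omega
      · rintro rfl
        exact ⟨h2.2 le_rfl, hc.2⟩
    have h2 : ∀ m ∈ Finset.Icc 0 (P.N i.rev), ¬ ((m = 0 ∨ B m + P.preLen n + P.len n i.rev < t) ∧
        (m = P.N i.rev ∨ t < B (m + 1) + 1)) := by
      rintro m hm ⟨h3, h4⟩
      have hm' := Finset.mem_Icc.1 hm
      have h5 := (hk k (Finset.mem_Icc.2 ⟨hc.1, hkN⟩)).2 le_rfl
      rcases lt_trichotomy m k with h | h | h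
      · have h6 := (hk (m + 1) (Finset.mem_Icc.2 ⟨by omega, by omega⟩)).2 (by omega)
        omega
      · subst h
        omega
      · have h6 := hsep' k m hc.1 h hm'.2
        omega
    rw [Finset.sum_congr rfl fun m hm => if_congr (h1 m hm) rfl rfl,
      Finset.sum_congr rfl fun m hm => if_neg (h2 m hm)]
    simp [hc.1, hkN]
  · have h1 : ∀ m ∈ Finset.Icc 1 (P.N i.rev),
        ¬ (B m + 1 ≤ t ∧ t ≤ B m + P.preLen n + P.len n i.rev) := by
      rintro m hm ⟨h3, h4⟩
      have hm' := Finset.mem_Icc.1 hm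
      have h2 := (hk m hm).1 h3
      rcases h2.eq_or_lt with h | h
      · subst h
        omega
      · have := hsep' m k hm'.1 h hkN
        have := (hk k (Finset.mem_Icc.2 ⟨by omega, hkN⟩)).2 le_rfl
        omega
    have h2 : ∀ m ∈ Finset.Icc 0 (P.N i.rev), (((m = 0 ∨ B m + P.preLen n + P.len n i.rev < t) ∧
        (m = P.N i.rev ∨ t < B (m + 1) + 1)) ↔ m = k) := by
      intro m hm
      have hm' := Finset.mem_Icc.1 hm
      constructor
      · rintro ⟨h3, h4⟩
        rcases lt_trichotomy m k with h | h | h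
        · have h6 := (hk (m + 1) (Finset.mem_Icc.2 ⟨by omega, by omega⟩)).2 (by omega)
          omega
        · exact h
        · have h6 := hk m (Finset.mem_Icc.2 ⟨by omega, by omega⟩)
          omega
      · rintro rfl
        refine ⟨by omega, ?_⟩
        by_cases h : m = P.N i.rev
        · exact Or.inl h
        · have h6 := hk (m + 1) (Finset.mem_Icc.2 ⟨by omega, by omega⟩)
          right
          by_contra h7
          have := h6.1 (by omega)
          omega
    rw [Finset.sum_congr rfl fun m hm => if_neg (h1 m hm),
      Finset.sum_congr rfl fun m hm => if_congr (h2 m hm) rfl rfl]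
    simp [hkN]

theorem offset_mem_of_omegaMinus_ne_zero (hminus : P.omegaMinus i j ≠ 0) :
    P.omegaMinus i j ∈ Finset.Icc 1 (P.N i.rev) ∧
      -P.θ i.rev < P.offset i j (P.omegaMinus i j) ∧
      P.offset i j (P.omegaMinus i j) < min 0 (P.θ i - P.θ i.rev) := by
  have h := Nat.nonempty_of_pos_sInf (Nat.pos_of_ne_zero hminus)
  exact Nat.sInf_mem h

theorem not_offset_mem_of_omegaPlus_eq_zero (hplus : P.omegaPlus i j = 0) {m : ℕ}
    (hm : m ∈ Finset.Icc 1 (P.N i.rev)) :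
    ¬ (max 0 (P.θ i - P.θ i.rev) < P.offset i j m ∧ P.offset i j m < P.θ i) := by
  intro h
  rcases Nat.sInf_eq_zero.1 hplus with h0 | h0
  · have := (Finset.mem_Icc.1 h0.1).1
    omega
  · have : m ∈ (∅ : Set ℕ) := h0 ▸ ⟨hm, h⟩
    exact this

theorem sum_interfered_card_le (himm : P.Immediate) (hs : P.Concentrated n δ s.1)
    (hn : (P.preLen n : ℝ) + 1 ≤ δ * n) (hδ : P.Margin i j δ) (hj : j ∈ Finset.Icc 1 (P.N i))
    (hminus : P.omegaMinus i j ≠ 0) (hplus : P.omegaPlus i j = 0) :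
    (∑ m ∈ Finset.Icc 1 (P.N i.rev), (interfered s i j m).card : ℝ) ≤
      n * (P.offset i j (P.omegaMinus i j) + P.θ i.rev * (1 + P.omega i j)) +
        P.N i.rev * (4 * δ * n) := by
  classical
  obtain ⟨hwm, hw1, hw2⟩ := offset_mem_of_omegaMinus_ne_zero hminus
  rw [lt_min_iff] at hw2
  have hθ' := P.θ_pos i.rev
  have hδn : 0 ≤ 4 * δ * n := by
    have := hδ.pos
    positivity
  have hterm : ∀ m ∈ Finset.Icc 1 (P.N i.rev), ((interfered s i j m).card : ℝ) ≤
      (if m = P.omegaMinus i j then n * (P.offset i j m + P.θ i.rev) else 0) +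
      (if (j : ℝ) * P.μ i + P.ν i ≤ (m : ℝ) * P.μ i.rev + P.ν i.rev ∧
        (m : ℝ) * P.μ i.rev + P.ν i.rev + P.θ i.rev ≤ (j : ℝ) * P.μ i + P.ν i + P.θ i
        then n * P.θ i.rev else 0) + 4 * δ * n := by
    intro m hm
    have ho : P.offset i j m = m * P.μ i.rev - j * P.μ i + P.ν i.rev - P.ν i := rfl
    have hnonneg : 0 ≤ (if m = P.omegaMinus i j then n * (P.offset i j m + P.θ i.rev) else 0) +
      (if (j : ℝ) * P.μ i + P.ν i ≤ (m : ℝ) * P.μ i.rev + P.ν i.rev ∧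
        (m : ℝ) * P.μ i.rev + P.ν i.rev + P.θ i.rev ≤ (j : ℝ) * P.μ i + P.ν i + P.θ i
        then n * P.θ i.rev else 0) + 4 * δ * n := by
      refine add_nonneg (add_nonneg ?_ ?_) hδn
      · split_ifs with h
        · rw [h]
          exact mul_nonneg n.cast_nonneg (by linarith)
        · exact le_rfl
      · split_ifs
        · positivity
        · exact le_rfl
    rcases (interfered s i j m).eq_empty_or_nonempty with he | ⟨t, ht⟩
    · rw [he]
      simpa using hnonneg
    · rw [mem_interfered] at ht
      have hA := abs_le.1 (near_codeword hs hn hj)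
      have hD := abs_le.1 (near_stop hs hn hj)
      have hB := abs_le.1 (near_start hs hn hm)
      have hC := abs_le.1 (near_stop hs hn hm)
      have hn0 : (0 : ℝ) ≤ n := n.cast_nonneg
      have hle : ∀ a b : ℕ, (∀ t ∈ interfered s i j m, a < t ∧ t ≤ b) → a ≤ b →
          ((interfered s i j m).card : ℝ) ≤ (b : ℝ) - a := by
        intro a b hab hle
        have : (interfered s i j m).card ≤ (Finset.Ioc a b).card :=
          Finset.card_le_card fun t ht => Finset.mem_Ioc.2 (hab t ht)
        rw [Nat.card_Ioc] at this
        rw [← Nat.cast_sub hle]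
        exact_mod_cast this
      by_cases hmw : m = P.omegaMinus i j
      · have h1 := hle (tau s i j + P.preLen n) (tau s i.rev m + P.preLen n + P.len n i.rev)
          (fun t ht => ⟨(mem_interfered.1 ht).1.1, (mem_interfered.1 ht).2.2⟩) (by omega)
        rw [if_pos hmw]
        have h2 : ((interfered s i j m).card : ℝ) ≤ n * (P.offset i j m + P.θ i.rev) +
            4 * δ * n := by
          rw [ho]
          linarith
        refine h2.trans ?_
        rw [add_assoc]
        gcongr
        refine le_add_of_nonneg_left ?_
        split_ifs
        · positivity
        · exact le_rfl
      · have hlt1 : 0 < P.offset i j m + P.θ i.rev := by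
          by_contra hneg
          have h1 := hδ.stop_start m hm
          rw [abs_of_nonpos (not_lt.1 hneg)] at h1
          have h2 := mul_le_mul_of_nonneg_left h1 hn0
          rw [ho] at h2
          have h3 : ((tau s i j + P.preLen n : ℕ) : ℝ) <
              ((tau s i.rev m + P.preLen n + P.len n i.rev : ℕ) : ℝ) := by
            exact_mod_cast ht.1.1.trans_le ht.2.2
          linarith
        have hlt2 : P.offset i j m < P.θ i := by
          by_contra hneg
          have h1 := hδ.start_stop m hm
          rw [abs_of_nonneg (by linarith)] at h1
          have h2 := mul_le_mul_of_nonneg_left h1 hn0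
          rw [ho] at h2
          have h3 : ((tau s i.rev m : ℕ) : ℝ) <
              ((tau s i j + P.preLen n + P.len n i : ℕ) : ℝ) := by
            exact_mod_cast ht.2.1.trans_le ht.1.2
          linarith
        have hN : 1 < P.N i.rev := by
          have := Finset.mem_Icc.1 hm
          have := Finset.mem_Icc.1 hwm
          omega
        have hsepw : P.θ i.rev < |P.offset i j m - P.offset i j (P.omegaMinus i j)| := by
          have e : P.offset i j m - P.offset i j (P.omegaMinus i j) =
              ((m : ℝ) - P.omegaMinus i j) * P.μ i.rev := by
            rw [offset, offset]
            ring
          rw [e, abs_mul, abs_of_pos (P.μ_pos _)]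
          have h1 : (1 : ℝ) ≤ |(m : ℝ) - P.omegaMinus i j| := by
            have : (1 : ℤ) ≤ |(m : ℤ) - P.omegaMinus i j| :=
              Int.one_le_abs (sub_ne_zero.2 (by exact_mod_cast hmw))
            exact_mod_cast this
          have h2 := himm i.rev hN
          have h3 := P.μ_pos i.rev
          nlinarith
        have hpos : 0 < P.offset i j m := by
          have h0 := hδ.start_start m hm
          have hp := hδ.pos
          by_contra hneg
          rcases abs_cases (P.offset i j m - P.offset i j (P.omegaMinus i j)) with ⟨e, _⟩ | ⟨e, _⟩ <;>
            linarith
        have hin : P.offset i j m ≤ P.θ i - P.θ i.rev := by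
          by_contra hneg
          exact not_offset_mem_of_omegaPlus_eq_zero hplus hm
            ⟨max_lt hpos (not_le.1 hneg), hlt2⟩
        have h1 := hle (tau s i.rev m) (tau s i.rev m + P.preLen n + P.len n i.rev)
          (fun t ht => ⟨(mem_interfered.1 ht).2.1, (mem_interfered.1 ht).2.2⟩) (by omega)
        rw [if_neg hmw, if_pos ⟨by linarith, by linarith⟩, zero_add]
        linarith
  refine (Finset.sum_le_sum hterm).trans (le_of_eq ?_)
  rw [Finset.sum_add_distrib, Finset.sum_add_distrib, Finset.sum_ite_eq', if_pos hwm,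
    ← Finset.sum_filter, Finset.sum_const, Finset.sum_const, Nat.card_Icc]
  have hω : P.omega i j = ((Finset.Icc 1 (P.N i.rev)).filter fun m : ℕ =>
      (j : ℝ) * P.μ i + P.ν i ≤ (m : ℝ) * P.μ i.rev + P.ν i.rev ∧
        (m : ℝ) * P.μ i.rev + P.ν i.rev + P.θ i.rev ≤ (j : ℝ) * P.μ i + P.ν i + P.θ i).card := by
    rw [omega, ← Set.ncard_coe_finset]
    congr 1
    ext m
    simp
  rw [hω]
  simp only [nsmul_eq_mul, Nat.add_sub_cancel]
  ring

end Pattern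

end Params

section Typicality

variable {Ω : Type*} [MeasurableSpace Ω] {Pr : Measure Ω}

theorem JointlyTypical.congr {ε : ℝ} {p : ℝ → ℝ → ℝ} {S : Finset ℕ} {x y x' y' : ℕ → ℝ}
    (h : JointlyTypical ε p S x y) (hx : ∀ t ∈ S, x t = x' t) (hy : ∀ t ∈ S, y t = y' t) :
    JointlyTypical ε p S x' y' := by
  have h₁ : ∑ t ∈ S, Real.logb 2 (marginal₁ p (x' t)) = ∑ t ∈ S, Real.logb 2 (marginal₁ p (x t)) :=
    Finset.sum_congr rfl fun t ht => by rw [hx t ht]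
  have h₂ : ∑ t ∈ S, Real.logb 2 (marginal₂ p (y' t)) = ∑ t ∈ S, Real.logb 2 (marginal₂ p (y t)) :=
    Finset.sum_congr rfl fun t ht => by rw [hy t ht]
  have h₃ : ∑ t ∈ S, Real.logb 2 (p (x' t) (y' t)) = ∑ t ∈ S, Real.logb 2 (p (x t) (y t)) :=
    Finset.sum_congr rfl fun t ht => by rw [hx t ht, hy t ht]
  rw [JointlyTypical, h₁, h₂, h₃]
  exact h

/-- Sum of the variances of the logarithms of the densities of `X`, `X + U` and `U`. -/
def typicalityConst (γ σ : ℝ≥0) : ℝ :=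
  variance (logGauss γ) (gaussianReal 0 γ) + variance (logGauss (γ + σ)) (gaussianReal 0 (γ + σ)) +
    variance (logGauss σ) (gaussianReal 0 σ)

theorem typicalityConst_nonneg (γ σ : ℝ≥0) : 0 ≤ typicalityConst γ σ :=
  add_nonneg (add_nonneg (variance_nonneg _ _) (variance_nonneg _ _)) (variance_nonneg _ _)

/-- The channel input and output of a memoryless Gaussian channel are jointly typical with high
probability. -/
theorem measure_not_jointlyTypical_le [IsProbabilityMeasure Pr] {S : Finset ℕ} (hS : S.Nonempty)
    {X U : ℕ → Ω → ℝ} {γ σ : ℝ≥0} (hγ : γ ≠ 0) (hσ : σ ≠ 0)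
    (hX : ∀ t ∈ S, HasLaw (X t) (gaussianReal 0 γ) Pr)
    (hU : ∀ t ∈ S, HasLaw (U t) (gaussianReal 0 σ) Pr)
    (hXU : ∀ t ∈ S, IndepFun (X t) (U t) Pr)
    (hind : Set.Pairwise (S : Set ℕ) fun s t =>
      IndepFun (fun ω => (X s ω, U s ω)) (fun ω => (X t ω, U t ω)) Pr) {ε : ℝ} (hε : 0 < ε) :
    Pr {ω | ¬ JointlyTypical ε (jointPDF γ σ) S (fun t => X t ω) (fun t => X t ω + U t ω)} ≤
      ENNReal.ofReal (4 * typicalityConst γ σ / (S.card * ε ^ 2)) := by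
  have hc : (0 : ℝ) < S.card := by exact_mod_cast hS.card_pos
  have hγσ : γ + σ ≠ 0 := by positivity
  have hY : ∀ t ∈ S, HasLaw (fun ω => X t ω + U t ω) (gaussianReal 0 (γ + σ)) Pr := fun t ht => by
    refine ⟨(hX t ht).aemeasurable.add (hU t ht).aemeasurable, ?_⟩
    have := gaussianReal_add_gaussianReal_of_indepFun (hXU t ht) (hX t ht).map_eq (hU t ht).map_eq
    rw [add_zero] at this
    exact this
  have h1 := measure_logGauss_deviation_le hS hγ hX
    (fun s hs t ht hst => (hind hs ht hst).comp measurable_fst measurable_fst) (half_pos hε)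
  have h2 := measure_logGauss_deviation_le hS hγσ hY
    (fun s hs t ht hst => (hind hs ht hst).comp (φ := fun z : ℝ × ℝ => z.1 + z.2)
      (ψ := fun z : ℝ × ℝ => z.1 + z.2) (by fun_prop) (by fun_prop)) (half_pos hε)
  have h3 := measure_logGauss_deviation_le hS hσ hU
    (fun s hs t ht hst => (hind hs ht hst).comp measurable_snd measurable_snd) (half_pos hε)
  have hsub : {ω | ¬ JointlyTypical ε (jointPDF γ σ) S (fun t => X t ω)
      (fun t => X t ω + U t ω)} ⊆
      ({ω | ε / 2 ≤ |(∑ t ∈ S, logGauss γ (X t ω)) / S.card + entropy₁ (gaussianPDFReal 0 γ)|} ∪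
      {ω | ε / 2 ≤ |(∑ t ∈ S, logGauss (γ + σ) (X t ω + U t ω)) / S.card +
        entropy₁ (gaussianPDFReal 0 (γ + σ))|}) ∪
      {ω | ε / 2 ≤ |(∑ t ∈ S, logGauss σ (U t ω)) / S.card + entropy₁ (gaussianPDFReal 0 σ)|} := by
    intro ω hω
    by_contra hcon
    simp only [Set.mem_union, not_or, Set.mem_ofPred_eq, not_le] at hcon
    obtain ⟨⟨c1, c2⟩, c3⟩ := hcon
    refine hω ⟨?_, ?_, ?_⟩
    · rw [marginal₁_jointPDF hσ]
      exact c1.trans (half_lt_self hε)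
    · rw [marginal₂_jointPDF hγ hσ]
      exact c2.trans (half_lt_self hε)
    · simp_rw [logb_jointPDF hγ hσ, add_sub_cancel_left]
      rw [entropy₂_jointPDF hγ hσ, Finset.sum_add_distrib, add_div, add_add_add_comm]
      exact (abs_add_le _ _).trans_lt (by linarith)
  refine (measure_mono hsub).trans ((measure_union_le _ _).trans ((add_le_add
    ((measure_union_le _ _).trans (add_le_add h1 h2)) h3).trans (le_of_eq ?_)))
  rw [← ENNReal.ofReal_add (by have := variance_nonneg (logGauss γ) (gaussianReal 0 γ); positivity)
    (by have := variance_nonneg (logGauss (γ + σ)) (gaussianReal 0 (γ + σ)); positivity),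
    ← ENNReal.ofReal_add (by
      have := variance_nonneg (logGauss γ) (gaussianReal 0 γ)
      have := variance_nonneg (logGauss (γ + σ)) (gaussianReal 0 (γ + σ))
      positivity) (by have := variance_nonneg (logGauss σ) (gaussianReal 0 σ); positivity)]
  congr 1
  rw [typicalityConst]
  field_simp
  ring

theorem sum_logb_likeRatio_ge {ε : ℝ} {γ σ : ℝ≥0} (hγ : γ ≠ 0) (hσ : σ ≠ 0) {S : Finset ℕ}
    {x y : ℕ → ℝ} (h : S.Nonempty → JointlyTypical ε (jointPDF γ σ) S x y) :
    S.card * (capFun (γ / σ) - 3 * ε) ≤ ∑ t ∈ S, Real.logb 2 (likeRatio γ σ (x t) (y t)) := by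
  rcases S.eq_empty_or_nonempty with rfl | hS
  · simp
  have hc : (0 : ℝ) < S.card := by exact_mod_cast hS.card_pos
  obtain ⟨h1, h2, h3⟩ := h hS
  rw [marginal₁_jointPDF hσ] at h1
  rw [marginal₂_jointPDF hγ hσ] at h2
  rw [entropy₂_jointPDF hγ hσ] at h3
  simp_rw [logb_likeRatio hγ hσ, Finset.sum_sub_distrib]
  have e1 := (abs_lt.1 h1).2
  have e2 := (abs_lt.1 h2).2
  have e3 := (abs_lt.1 h3).1
  have hcap := entropy₁_gaussian_sub hγ hσ
  have key : capFun (γ / σ) - 3 * ε ≤ ((∑ t ∈ S, Real.logb 2 (jointPDF γ σ (x t) (y t))) -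
      ∑ t ∈ S, logGauss γ (x t) - ∑ t ∈ S, logGauss (γ + σ) (y t)) / S.card := by
    rw [sub_div, sub_div]
    simp only [logGauss]
    linarith
  rwa [le_div_iff₀ hc, mul_comm] at key

theorem lintegral_prod_likeRatio [IsProbabilityMeasure Pr] {W : Finset ℕ} {X Y : ℕ → Ω → ℝ}
    {γ : ℝ≥0} (hγ : γ ≠ 0) {σ : ℕ → ℝ≥0} (hσ : ∀ t, σ t ≠ 0)
    (hXm : ∀ t ∈ W, Measurable (X t)) (hYm : ∀ t ∈ W, Measurable (Y t))
    (hX : ∀ t ∈ W, HasLaw (X t) (gaussianReal 0 γ) Pr)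
    (hXi : iIndepFun (fun (t : W) => X t) Pr)
    (hXY : IndepFun (fun ω (t : W) => X t ω) (fun ω (t : W) => Y t ω) Pr) :
    ∫⁻ ω, ∏ t ∈ W, ENNReal.ofReal (likeRatio γ (σ t) (X t ω) (Y t ω)) ∂Pr = 1 := by
  have hXt : Measurable fun ω (t : W) => X t ω := measurable_pi_lambda _ fun t => hXm t t.2
  have hYt : Measurable fun ω (t : W) => Y t ω := measurable_pi_lambda _ fun t => hYm t t.2
  have hXlaw : Pr.map (fun ω (t : W) => X t ω) = Measure.pi fun _ => gaussianReal 0 γ := by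
    rw [iIndepFun.map_fun_eq_pi_map (f := fun t : W => X t)
      (fun t => (hXm t t.2).aemeasurable) hXi]
    congr
    funext t
    exact (hX t t.2).map_eq
  have hF : ∀ t : W, Measurable fun z : (W → ℝ) × (W → ℝ) =>
      ENNReal.ofReal (likeRatio γ (σ t) (z.1 t) (z.2 t)) := fun t =>
    ((measurable_likeRatio γ (σ t)).comp (by fun_prop :
      Measurable fun z : (W → ℝ) × (W → ℝ) => (z.1 t, z.2 t))).ennreal_ofReal
  have hFp : Measurable fun z : (W → ℝ) × (W → ℝ) =>
      ∏ t : W, ENNReal.ofReal (likeRatio γ (σ t) (z.1 t) (z.2 t)) :=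
    Finset.measurable_prod _ fun t _ => hF t
  have : IsProbabilityMeasure (Pr.map fun ω (t : W) => Y t ω) :=
    Measure.isProbabilityMeasure_map hYt.aemeasurable
  calc ∫⁻ ω, ∏ t ∈ W, ENNReal.ofReal (likeRatio γ (σ t) (X t ω) (Y t ω)) ∂Pr
      = ∫⁻ ω, ∏ t : W, ENNReal.ofReal (likeRatio γ (σ t) (X t ω) (Y t ω)) ∂Pr := by
        refine lintegral_congr fun ω => ?_
        rw [← Finset.prod_coe_sort]
    _ = ∫⁻ z, ∏ t : W, ENNReal.ofReal (likeRatio γ (σ t) (z.1 t) (z.2 t))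
          ∂(Pr.map fun ω => ((fun t : W => X t ω), fun t : W => Y t ω)) :=
        (lintegral_map hFp (hXt.prodMk hYt)).symm
    _ = 1 := by
        rw [(indepFun_iff_map_prod_eq_prod_map_map hXt.aemeasurable hYt.aemeasurable).1 hXY, hXlaw,
          lintegral_prod_symm _ hFp.aemeasurable]
        have : ∀ y : W → ℝ, ∫⁻ x, ∏ t : W, ENNReal.ofReal (likeRatio γ (σ t) (x t) (y t))
            ∂(Measure.pi fun _ : W => gaussianReal 0 γ) = 1 := fun y => by
          have hm : ∀ t : W, Measurable fun x : ℝ =>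
              ENNReal.ofReal (likeRatio γ (σ t) x (y t)) := fun t =>
            ((measurable_likeRatio γ (σ t)).comp (by fun_prop :
              Measurable fun x : ℝ => (x, y t))).ennreal_ofReal
          rw [lintegral_prod_eq_prod_lintegral_of_indepFun Finset.univ
            (fun (t : W) (x : W → ℝ) => ENNReal.ofReal (likeRatio γ (σ t) (x t) (y t)))
            (iIndepFun_pi (X := fun (t : W) x => ENNReal.ofReal (likeRatio γ (σ t) x (y t)))
              fun t => (hm t).aemeasurable) fun t => (hm t).comp (measurable_pi_apply t)]
          refine Finset.prod_eq_one fun t _ => ?_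
          rw [(measurePreserving_eval (fun _ : W => gaussianReal 0 γ) t).lintegral_comp (hm t),
            lintegral_likeRatio hγ (hσ t)]
        simp only [this, lintegral_one, measure_univ]

/-- Markov's inequality for the likelihood ratio of an independent codeword. -/
theorem measure_le_sum_logb_likeRatio_le [IsProbabilityMeasure Pr] {W : Finset ℕ}
    {X Y : ℕ → Ω → ℝ} {γ : ℝ≥0} (hγ : γ ≠ 0) {σ : ℕ → ℝ≥0} (hσ : ∀ t, σ t ≠ 0)
    (hXm : ∀ t ∈ W, Measurable (X t)) (hYm : ∀ t ∈ W, Measurable (Y t))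
    (hX : ∀ t ∈ W, HasLaw (X t) (gaussianReal 0 γ) Pr)
    (hXi : iIndepFun (fun (t : W) => X t) Pr)
    (hXY : IndepFun (fun ω (t : W) => X t ω) (fun ω (t : W) => Y t ω) Pr) (B : ℝ) :
    Pr {ω | B ≤ ∑ t ∈ W, Real.logb 2 (likeRatio γ (σ t) (X t ω) (Y t ω))} ≤
      ENNReal.ofReal (2 ^ (-B)) := by
  have hm : Measurable fun ω => ∏ t ∈ W, ENNReal.ofReal (likeRatio γ (σ t) (X t ω) (Y t ω)) :=
    Finset.measurable_prod _ fun t ht => ((measurable_likeRatio γ (σ t)).comp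
      ((hXm t ht).prodMk (hYm t ht))).ennreal_ofReal
  have h := mul_meas_ge_le_lintegral hm (μ := Pr) (ENNReal.ofReal ((2 : ℝ) ^ B))
  rw [lintegral_prod_likeRatio hγ hσ hXm hYm hX hXi hXY] at h
  have hpos : (0 : ℝ) < 2 ^ B := by positivity
  rw [Real.rpow_neg (by norm_num), ENNReal.ofReal_inv_of_pos hpos]
  rw [mul_comm, ← ENNReal.le_div_iff_mul_le (Or.inl (by simpa using hpos)) (Or.inl (by simp)),
    one_div] at h
  refine (measure_mono fun ω hω => ?_).trans h
  simp only [Set.mem_ofPred_eq] at hω ⊢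
  have hp : ∀ t ∈ W, 0 < likeRatio γ (σ t) (X t ω) (Y t ω) := fun t _ => likeRatio_pos hγ (hσ t) _ _
  rw [← Real.logb_prod _ _ fun t ht => (hp t ht).ne', Real.le_logb_iff_rpow_le (by norm_num)
    (Finset.prod_pos hp)] at hω
  rw [← ENNReal.ofReal_prod_of_nonneg fun t ht => (hp t ht).le]
  exact ENNReal.ofReal_le_ofReal hω

end Typicality

namespace Params

variable {P : Params}

/-- The user that sends a Gaussian variable, if it is not noise. -/
def signalUser {n : ℕ} : P.Coord n → Option (Fin 2)
  | .inl p => some p.1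
  | .inr (.inl p) => some p.1
  | .inr (.inr _) => none

/-- Index of the symbol sent in slot `t` of a burst of user `u` that starts after slot `τ` and
carries the message `m`. -/
def symbolCoord {n : ℕ} (u : Fin 2) (τ : ℕ) (m : P.Msg n u) (t : ℕ) : P.Coord n :=
  if h : τ < t ∧ t ≤ τ + P.preLen n then .inr (.inl (u, ⟨t - (τ + 1), by omega⟩))
  else if h : τ + P.preLen n < t ∧ t ≤ τ + P.preLen n + P.len n u then
    .inl ⟨u, m, ⟨t - (τ + P.preLen n + 1), by omega⟩⟩
  else .inr (.inr (u, t))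

/-- Index of the noise at receiver `u` in slot `t`. -/
def noiseCoord {n : ℕ} (u : Fin 2) (t : ℕ) : P.Coord n := .inr (.inr (u, t))

theorem noiseCoord_injective {n : ℕ} (u : Fin 2) :
    Function.Injective (noiseCoord (P := P) (n := n) u) := fun s t h => by
  simpa [noiseCoord] using h

section Symbols

variable {n : ℕ} {u : Fin 2} {τ t : ℕ} {m : P.Msg n u}

theorem symbolCoord_of_preamble (h : τ < t ∧ t ≤ τ + P.preLen n) :
    symbolCoord u τ m t = .inr (.inl (u, ⟨t - (τ + 1), by omega⟩)) := dif_pos h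

theorem symbolCoord_of_codeword (h : τ + P.preLen n < t ∧ t ≤ τ + P.preLen n + P.len n u) :
    symbolCoord u τ m t = .inl ⟨u, m, ⟨t - (τ + P.preLen n + 1), by omega⟩⟩ := by
  rw [symbolCoord, dif_neg (by omega), dif_pos h]

theorem signalUser_symbolCoord (h : τ < t ∧ t ≤ τ + P.preLen n + P.len n u) :
    signalUser (symbolCoord u τ m t) = some u := by
  by_cases h' : t ≤ τ + P.preLen n
  · rw [symbolCoord_of_preamble ⟨h.1, h'⟩]
    rfl
  · rw [symbolCoord_of_codeword ⟨by omega, h.2⟩]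
    rfl

theorem coordVar_of_signalUser {k : P.Coord n} (h : signalUser k = some u) :
    coordVar k = P.γ u := by
  rcases k with p | p | p
  · simp only [signalUser, Option.some.injEq] at h
    rw [← h]
    rfl
  · simp only [signalUser, Option.some.injEq] at h
    rw [← h]
    rfl
  · simp [signalUser] at h

theorem symbolCoord_inj {t' : ℕ} (h : τ < t ∧ t ≤ τ + P.preLen n + P.len n u)
    (h' : τ < t' ∧ t' ≤ τ + P.preLen n + P.len n u)
    (heq : symbolCoord u τ m t = symbolCoord u τ m t') : t = t' := by
  by_cases h1 : t ≤ τ + P.preLen n <;> by_cases h2 : t' ≤ τ + P.preLen n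
  · rw [symbolCoord_of_preamble ⟨h.1, h1⟩, symbolCoord_of_preamble ⟨h'.1, h2⟩] at heq
    simp only [Sum.inr.injEq, Sum.inl.injEq, Prod.mk.injEq, Fin.mk.injEq, true_and] at heq
    omega
  · rw [symbolCoord_of_preamble ⟨h.1, h1⟩, symbolCoord_of_codeword ⟨by omega, h'.2⟩] at heq
    simp at heq
  · rw [symbolCoord_of_codeword ⟨by omega, h.2⟩, symbolCoord_of_preamble ⟨h'.1, h2⟩] at heq
    simp at heq
  · rw [symbolCoord_of_codeword ⟨by omega, h.2⟩, symbolCoord_of_codeword ⟨by omega, h'.2⟩] at heq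
    simp only [Sum.inl.injEq, Sigma.mk.injEq, heq_eq_eq, Prod.mk.injEq, Fin.mk.injEq,
      true_and] at heq
    omega

theorem place_codeword_eq (h : τ + P.preLen n < t ∧ t ≤ τ + P.preLen n + P.len n u)
    (r : P.Rest n) : place (r.1 u m) (τ + P.preLen n + 1) t = coord (symbolCoord u τ m t) r := by
  rw [symbolCoord_of_codeword h, place, dif_pos (by omega)]
  rfl

theorem place_add_place_eq (h : τ < t ∧ t ≤ τ + P.preLen n + P.len n u) (r : P.Rest n) :
    place (r.2.1 u) (τ + 1) t + place (r.1 u m) (τ + P.preLen n + 1) t =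
      coord (symbolCoord u τ m t) r := by
  by_cases h' : t ≤ τ + P.preLen n
  · rw [symbolCoord_of_preamble ⟨h.1, h'⟩, place, dif_pos (by omega), place, dif_neg (by omega),
      add_zero]
    rfl
  · rw [← place_codeword_eq ⟨by omega, h.2⟩, add_eq_right, place, dif_neg (by omega)]

theorem place_add_place_eq_zero (h : ¬ (τ < t ∧ t ≤ τ + P.preLen n + P.len n u)) (r : P.Rest n) :
    place (r.2.1 u) (τ + 1) t + place (r.1 u m) (τ + P.preLen n + 1) t = 0 := by
  rw [place, dif_neg (by omega), place, dif_neg (by omega), add_zero]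

end Symbols

section Signals

variable {n : ℕ} {α : Arrivals} {u : Fin 2}

theorem signal_of_mem_burst (hsep : P.Separated n α u) (w : ℕ → P.Msg n u) {l : ℕ}
    (hl : l ∈ Finset.Icc 1 (P.N u)) {t : ℕ} (ht : P.schedTime n u (α u) l < t ∧
      t ≤ P.schedTime n u (α u) l + P.preLen n + P.len n u) (r : P.Rest n) :
    signal (α, r) u w t = coord (symbolCoord u (P.schedTime n u (α u) l) (w l) t) r := by
  rw [signal, Finset.sum_eq_single_of_mem l hl]
  · exact place_add_place_eq ht r
  · intro l' hl' hne
    refine place_add_place_eq_zero (P := P) ?_ r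
    have h1 := Finset.mem_Icc.1 hl
    have h2 := Finset.mem_Icc.1 hl'
    simp only [tau]
    rcases hne.lt_or_gt with h | h
    · have := hsep l' l h2.1 h h1.2
      omega
    · have := hsep l l' h1.1 h h2.2
      omega

theorem signal_of_notMem_burst (w : ℕ → P.Msg n u) {t : ℕ}
    (ht : ∀ l ∈ Finset.Icc 1 (P.N u), ¬ (P.schedTime n u (α u) l < t ∧
      t ≤ P.schedTime n u (α u) l + P.preLen n + P.len n u)) (r : P.Rest n) :
    signal (α, r) u w t = 0 :=
  Finset.sum_eq_zero fun l hl => place_add_place_eq_zero (P := P) (ht l hl) r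

theorem signal_eq_coord_or_zero (hsep : P.Separated n α u) (w : ℕ → P.Msg n u) (t : ℕ) :
    (∃ k : P.Coord n, signalUser k = some u ∧ ∀ r, signal (α, r) u w t = coord k r) ∨
      ∀ r : P.Rest n, signal (α, r) u w t = 0 := by
  by_cases h : ∃ l ∈ Finset.Icc 1 (P.N u), P.schedTime n u (α u) l < t ∧
      t ≤ P.schedTime n u (α u) l + P.preLen n + P.len n u
  · obtain ⟨l, hl, ht⟩ := h
    exact Or.inl ⟨_, signalUser_symbolCoord ht, signal_of_mem_burst hsep w hl ht⟩
  · push Not at h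
    exact Or.inr (signal_of_notMem_burst w fun l hl ht => absurd ht.2 (not_le.2 (h l hl ht.1)))

end Signals

section FixedArrivals

variable {n : ℕ} {α : Arrivals} {i : Fin 2} {j : ℕ}

theorem rev_ne (i : Fin 2) : i.rev ≠ i := by
  fin_cases i <;> decide

theorem indepFun_coord {X Y : P.Rest n → ℝ} {S T : Set (P.Coord n)} (hST : Disjoint S T)
    (hX : Measurable[sigmaOf coord S] X) (hY : Measurable[sigmaOf coord T] Y) :
    IndepFun X Y (P.restLaw n) :=
  indepFun_of_disjoint (P.iIndepFun_coord n) measurable_coord hST hX hY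

/-- A memoryless channel whose noise is generated by Gaussian variables with separate indices. -/
theorem measure_not_jointlyTypical_coord_le {S : Finset ℕ} (hS : S.Nonempty)
    {X U : ℕ → P.Rest n → ℝ} {γ σ : ℝ≥0} (hγ : γ ≠ 0) (hσ : σ ≠ 0)
    (hX : ∀ t ∈ S, HasLaw (X t) (gaussianReal 0 γ) (P.restLaw n))
    (hU : ∀ t ∈ S, HasLaw (U t) (gaussianReal 0 σ) (P.restLaw n))
    {A B : ℕ → Set (P.Coord n)} (hXA : ∀ t ∈ S, Measurable[sigmaOf coord (A t)] (X t))
    (hUB : ∀ t ∈ S, Measurable[sigmaOf coord (B t)] (U t)) (hAB : ∀ t ∈ S, Disjoint (A t) (B t))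
    (hdis : ∀ s ∈ S, ∀ t ∈ S, s ≠ t → Disjoint (A s ∪ B s) (A t ∪ B t)) {ε : ℝ} (hε : 0 < ε) :
    P.restLaw n {r | ¬ JointlyTypical ε (jointPDF γ σ) S (fun t => X t r)
      (fun t => X t r + U t r)} ≤ ENNReal.ofReal (4 * typicalityConst γ σ / (S.card * ε ^ 2)) := by
  refine measure_not_jointlyTypical_le hS hγ hσ hX hU
    (fun t ht => indepFun_coord (hAB t ht) (hXA t ht) (hUB t ht)) (fun s hs t ht hst => ?_) hε
  have hm : ∀ t ∈ S, Measurable[sigmaOf coord (A t ∪ B t)] fun r => (X t r, U t r) := fun t ht =>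
    ((hXA t ht).mono (biSup_mono fun _ => Or.inl) le_rfl).prodMk
      ((hUB t ht).mono (biSup_mono fun _ => Or.inr) le_rfl)
  exact indepFun_of_disjoint (P.iIndepFun_coord n) measurable_coord (hdis s hs t ht hst)
    (hm s hs) (hm t ht)

theorem received_of_mem_window (hsep : P.Separated n α i) (w : (i : Fin 2) → ℕ → P.Msg n i)
    (hj : j ∈ Finset.Icc 1 (P.N i)) {t : ℕ} {r₀ : P.Rest n} (ht : t ∈ window (α, r₀) i j)
    (r : P.Rest n) : received (α, r) w i t =
      coord (symbolCoord i (P.schedTime n i (α i) j) (w i j) t) r +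
        (Real.sqrt (P.a i.rev) * signal (α, r) i.rev (w i.rev) t + coord (noiseCoord i t) r) := by
  have ht' := mem_window.1 ht
  simp only [tau] at ht'
  rw [received, signal_of_mem_burst hsep (w i) hj (by omega), add_assoc]
  rfl

theorem hasLaw_symbolCoord {u : Fin 2} {τ t : ℕ} {m : P.Msg n u}
    (h : τ < t ∧ t ≤ τ + P.preLen n + P.len n u) :
    HasLaw (coord (symbolCoord u τ m t)) (gaussianReal 0 (P.γ u)) (P.restLaw n) := by
  rw [← coordVar_of_signalUser (signalUser_symbolCoord (m := m) h)]
  exact hasLaw_coord _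

theorem ne_of_signalUser_ne {k k' : P.Coord n} (h : signalUser k ≠ signalUser k') : k ≠ k' :=
  fun e => h (e ▸ rfl)

/-- The variance of noise plus interference at receiver `i`. -/
def interfVar (P : Params) (i : Fin 2) : ℝ≥0 := 1 + P.a i.rev * P.γ i.rev

theorem interfVar_ne_zero (i : Fin 2) : P.interfVar i ≠ 0 := by
  unfold interfVar
  positivity

theorem hasLaw_interference {k k' : P.Coord n} (hk : k ≠ k')
    (h : HasLaw (coord k) (gaussianReal 0 (P.γ i.rev)) (P.restLaw n)) (hk' : coordVar k' = 1) :
    HasLaw (fun r => Real.sqrt (P.a i.rev) * coord k r + coord k' r)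
      (gaussianReal 0 (P.interfVar i)) (P.restLaw n) := by
  have hd := gaussianReal_const_mul h (Real.sqrt (P.a i.rev))
  have hz := hasLaw_coord k'
  rw [hk'] at hz
  have hind : IndepFun (fun r => Real.sqrt (P.a i.rev) * coord k r) (coord k') (P.restLaw n) :=
    indepFun_coord (S := {k}) (T := {k'}) (Set.disjoint_singleton.2 hk)
      ((measurable_sigmaOf coord (Set.mem_singleton k)).const_mul _)
      (measurable_sigmaOf coord (Set.mem_singleton k'))
  refine ⟨hd.aemeasurable.add hz.aemeasurable, ?_⟩
  have hsum := gaussianReal_add_gaussianReal_of_indepFun hind hd.map_eq hz.map_eq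
  have hv : NNReal.mk (Real.sqrt (P.a i.rev) ^ 2) (sq_nonneg _) * P.γ i.rev + 1 =
      P.interfVar i := by
    rw [interfVar, add_comm]
    congr 2
    ext
    simp
  rw [mul_zero, add_zero, hv] at hsum
  exact hsum

theorem measure_interfered_not_typical_le (hsep : P.Separated n α i)
    (hsep' : P.Separated n α i.rev) (w : (i : Fin 2) → ℕ → P.Msg n i)
    (hj : j ∈ Finset.Icc 1 (P.N i)) {m : ℕ} (hm : m ∈ Finset.Icc 1 (P.N i.rev)) {r₀ : P.Rest n}
    (hne : (interfered (α, r₀) i j m).Nonempty) {ε : ℝ} (hε : 0 < ε) :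
    P.restLaw n {r | ¬ JointlyTypical ε (P.densInterf i) (interfered (α, r₀) i j m)
      (place (r.1 i (w i j)) (P.schedTime n i (α i) j + P.preLen n + 1))
      (received (α, r) w i)} ≤
      ENNReal.ofReal (4 * typicalityConst (P.γ i) (P.interfVar i) /
        ((interfered (α, r₀) i j m).card * ε ^ 2)) := by
  set S := interfered (α, r₀) i j m with hS
  set c : ℕ → P.Coord n := symbolCoord i (P.schedTime n i (α i) j) (w i j)
  set d : ℕ → P.Coord n := symbolCoord i.rev (P.schedTime n i.rev (α i.rev) m) (w i.rev m)
  have hmem : ∀ t ∈ S, (P.schedTime n i (α i) j + P.preLen n < t ∧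
      t ≤ P.schedTime n i (α i) j + P.preLen n + P.len n i) ∧
      P.schedTime n i.rev (α i.rev) m < t ∧
      t ≤ P.schedTime n i.rev (α i.rev) m + P.preLen n + P.len n i.rev := fun t ht =>
    mem_interfered.1 ht
  have hcu : ∀ t ∈ S, signalUser (c t) = some i := fun t ht =>
    signalUser_symbolCoord (by have := hmem t ht; omega)
  have hdu : ∀ t ∈ S, signalUser (d t) = some i.rev := fun t ht =>
    signalUser_symbolCoord (by have := hmem t ht; omega)
  have hzu : ∀ t, signalUser (noiseCoord (P := P) (n := n) i t) = none := fun t => rfl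
  have hcd : ∀ s ∈ S, ∀ t ∈ S, c s ≠ d t := fun s hs t ht => ne_of_signalUser_ne (by
    rw [hcu s hs, hdu t ht]
    exact fun h => rev_ne i (Option.some.inj h).symm)
  have hcz : ∀ s ∈ S, ∀ t, c s ≠ noiseCoord i t := fun s hs t => ne_of_signalUser_ne (by
    rw [hcu s hs, hzu]
    simp)
  have hdz : ∀ s ∈ S, ∀ t, d s ≠ noiseCoord i t := fun s hs t => ne_of_signalUser_ne (by
    rw [hdu s hs, hzu]
    simp)
  have hcc : ∀ s ∈ S, ∀ t ∈ S, s ≠ t → c s ≠ c t := fun s hs t ht hst h => hst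
    (symbolCoord_inj (by have := hmem s hs; omega) (by have := hmem t ht; omega) h)
  have hdd : ∀ s ∈ S, ∀ t ∈ S, s ≠ t → d s ≠ d t := fun s hs t ht hst h => hst
    (symbolCoord_inj (by have := hmem s hs; omega) (by have := hmem t ht; omega) h)
  have hzz : ∀ s t, s ≠ t → noiseCoord (P := P) (n := n) i s ≠ noiseCoord i t :=
    fun s t hst h => hst (noiseCoord_injective i h)
  have h := measure_not_jointlyTypical_coord_le (n := n) (S := S) hne
    (X := fun t => coord (c t))
    (U := fun t r => Real.sqrt (P.a i.rev) * coord (d t) r + coord (noiseCoord i t) r)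
    (γ := P.γ i) (σ := P.interfVar i) (P.γ_pos i).ne' (interfVar_ne_zero i)
    (fun t ht => hasLaw_symbolCoord (by have := hmem t ht; omega)) (fun t ht => ?_)
    (A := fun t => {c t}) (B := fun t => {d t, noiseCoord i t})
    (fun t ht => measurable_sigmaOf coord rfl)
    (fun t ht => ((measurable_sigmaOf coord (Or.inl rfl)).const_mul _).add
      (measurable_sigmaOf coord (Or.inr rfl))) (fun t ht => ?_) (fun s hs t ht hst => ?_) hε
  · refine (measure_mono fun r hr => ?_).trans h
    simp only [Set.mem_ofPred_eq] at hr ⊢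
    refine fun htyp => hr (htyp.congr ?_ ?_)
    · intro t ht
      exact (place_codeword_eq (hmem t ht).1 r).symm
    · intro t ht
      rw [received_of_mem_window hsep w hj (r₀ := r₀) (mem_window.2 (hmem t ht).1),
        signal_of_mem_burst hsep' (w i.rev) hm (hmem t ht).2]
  · exact hasLaw_interference (hdz t ht t) (hasLaw_symbolCoord (hmem t ht).2) rfl
  · simp only [Set.disjoint_singleton_left, Set.mem_insert_iff, Set.mem_singleton_iff, not_or]
    exact ⟨hcd t ht t ht, hcz t ht t⟩
  · rw [Set.disjoint_left]
    rintro x (rfl | rfl | rfl) (h | h | h)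
    · exact hcc s hs t ht hst h
    · exact hcd s hs t ht h
    · exact hcz s hs t h
    · exact hcd t ht s hs h.symm
    · exact hdd s hs t ht hst h
    · exact hdz s hs t h
    · exact hcz t ht s h.symm
    · exact hdz t ht s h.symm
    · exact hzz s t hst h

theorem notMem_burst_of_mem_clean (hsep' : P.Separated n α i.rev) {m t : ℕ} {r₀ : P.Rest n}
    (hm : m ∈ Finset.Icc 0 (P.N i.rev)) (ht : t ∈ clean (α, r₀) i j m) :
    ∀ l ∈ Finset.Icc 1 (P.N i.rev), ¬ (P.schedTime n i.rev (α i.rev) l < t ∧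
      t ≤ P.schedTime n i.rev (α i.rev) l + P.preLen n + P.len n i.rev) := by
  intro l hl h
  have hl' := Finset.mem_Icc.1 hl
  have hm' := Finset.mem_Icc.1 hm
  have ht' := (mem_clean.1 ht).2
  simp only [tau] at ht'
  rcases lt_trichotomy l m with hlm | hlm | hlm
  · have := hsep' l m hl'.1 hlm hm'.2
    omega
  · subst hlm
    omega
  · rcases (show m + 1 ≤ l from hlm).eq_or_lt with h1 | h1
    · subst h1
      omega
    · have := hsep' (m + 1) l (by omega) h1 hl'.2
      omega

theorem measure_clean_not_typical_le (hsep : P.Separated n α i)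
    (hsep' : P.Separated n α i.rev) (w : (i : Fin 2) → ℕ → P.Msg n i)
    (hj : j ∈ Finset.Icc 1 (P.N i)) {m : ℕ} (hm : m ∈ Finset.Icc 0 (P.N i.rev)) {r₀ : P.Rest n}
    (hne : (clean (α, r₀) i j m).Nonempty) {ε : ℝ} (hε : 0 < ε) :
    P.restLaw n {r | ¬ JointlyTypical ε (P.densClean i) (clean (α, r₀) i j m)
      (place (r.1 i (w i j)) (P.schedTime n i (α i) j + P.preLen n + 1))
      (received (α, r) w i)} ≤
      ENNReal.ofReal (4 * typicalityConst (P.γ i) 1 /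
        ((clean (α, r₀) i j m).card * ε ^ 2)) := by
  set S := clean (α, r₀) i j m with hS
  set c : ℕ → P.Coord n := symbolCoord i (P.schedTime n i (α i) j) (w i j)
  have hmem : ∀ t ∈ S, P.schedTime n i (α i) j + P.preLen n < t ∧
      t ≤ P.schedTime n i (α i) j + P.preLen n + P.len n i := fun t ht =>
    (mem_clean.1 ht).1
  have hcu : ∀ t ∈ S, signalUser (c t) = some i := fun t ht =>
    signalUser_symbolCoord (by have := hmem t ht; omega)
  have hzu : ∀ t, signalUser (noiseCoord (P := P) (n := n) i t) = none := fun t => rfl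
  have hcz : ∀ s ∈ S, ∀ t, c s ≠ noiseCoord i t := fun s hs t => ne_of_signalUser_ne (by
    rw [hcu s hs, hzu]
    simp)
  have hcc : ∀ s ∈ S, ∀ t ∈ S, s ≠ t → c s ≠ c t := fun s hs t ht hst h => hst
    (symbolCoord_inj (by have := hmem s hs; omega) (by have := hmem t ht; omega) h)
  have hzz : ∀ s t, s ≠ t → noiseCoord (P := P) (n := n) i s ≠ noiseCoord i t :=
    fun s t hst h => hst (noiseCoord_injective i h)
  have h := measure_not_jointlyTypical_coord_le (n := n) (S := S) hne
    (X := fun t => coord (c t)) (U := fun t => coord (noiseCoord i t))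
    (γ := P.γ i) (σ := 1) (P.γ_pos i).ne' one_ne_zero
    (fun t ht => hasLaw_symbolCoord (by have := hmem t ht; omega))
    (fun t ht => hasLaw_coord (noiseCoord i t))
    (A := fun t => {c t}) (B := fun t => {noiseCoord i t})
    (fun t ht => measurable_sigmaOf coord rfl) (fun t ht => measurable_sigmaOf coord rfl)
    (fun t ht => Set.disjoint_singleton.2 (hcz t ht t)) (fun s hs t ht hst => ?_) hε
  · refine (measure_mono fun r hr => ?_).trans h
    simp only [Set.mem_ofPred_eq] at hr ⊢
    refine fun htyp => hr (htyp.congr ?_ ?_)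
    · intro t ht
      exact (place_codeword_eq (hmem t ht) r).symm
    · intro t ht
      rw [received_of_mem_window hsep w hj (r₀ := r₀) (mem_window.2 (hmem t ht)),
        signal_of_notMem_burst (w i.rev) (notMem_burst_of_mem_clean hsep' hm ht), mul_zero,
        zero_add]
  · rw [Set.disjoint_left]
    rintro x (rfl | rfl) (h | h)
    · exact hcc s hs t ht hst h
    · exact hcz s hs t h
    · exact hcz t ht s h.symm
    · exact hzz s t hst h

/-- Bound on the probability that a given wrong codeword passes the test. -/
theorem measure_passes_le (hsep : P.Separated n α i) (hsep' : P.Separated n α i.rev)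
    (w : (i : Fin 2) → ℕ → P.Msg n i) (hj : j ∈ Finset.Icc 1 (P.N i)) {m : P.Msg n i}
    (hmw : m ≠ w i j) {r₀ : P.Rest n} {ε : ℝ} :
    P.restLaw n {r | Passes (α, r) ε i j (received (α, r) w i) m} ≤
      ENNReal.ofReal (2 ^ (-(P.len n i * (P.φ i - 3 * ε) - (P.φ i - P.ψ i) *
        ∑ m ∈ Finset.Icc 1 (P.N i.rev), ((interfered (α, r₀) i j m).card : ℝ)))) := by
  classical
  set W := window (α, r₀) i j with hW
  set τ := P.schedTime n i (α i) j with hτ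
  set X : ℕ → P.Rest n → ℝ := fun t => coord (symbolCoord i τ m t) with hX
  set Y : ℕ → P.Rest n → ℝ := fun t r => received (α, r) w i t with hY
  set σ : ℕ → ℝ≥0 := fun t => if ∃ l ∈ Finset.Icc 1 (P.N i.rev), t ∈ interfered (α, r₀) i j l
    then P.interfVar i else 1 with hσ
  have hσ0 : ∀ t, σ t ≠ 0 := fun t => by
    simp only [hσ]
    split_ifs
    · exact interfVar_ne_zero i
    · exact one_ne_zero
  have hWm : ∀ t ∈ W, τ + P.preLen n < t ∧ t ≤ τ + P.preLen n + P.len n i := fun t ht =>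
    mem_window.1 ht
  set A : Set (P.Coord n) := {k | ∃ l, k = .inl ⟨i, m, l⟩} with hA
  have hXA : ∀ t ∈ W, Measurable[sigmaOf coord A] (X t) := fun t ht =>
    measurable_sigmaOf coord ⟨_, symbolCoord_of_codeword (hWm t ht)⟩
  have hYA : ∀ t ∈ W, Measurable[sigmaOf coord Aᶜ] (Y t) := by
    intro t ht
    have hc : Measurable[sigmaOf coord Aᶜ] (coord (symbolCoord i τ (w i j) t)) := by
      refine measurable_sigmaOf coord ?_
      rw [symbolCoord_of_codeword (hWm t ht)]
      rintro ⟨l, h⟩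
      simp only [Sum.inl.injEq, Sigma.mk.injEq, heq_eq_eq, Prod.mk.injEq, true_and] at h
      exact hmw h.1.symm
    have hz : Measurable[sigmaOf coord Aᶜ] (coord (noiseCoord (P := P) (n := n) i t)) := by
      refine measurable_sigmaOf coord ?_
      rintro ⟨l, h⟩
      simp [noiseCoord] at h
    have hs : Measurable[sigmaOf coord Aᶜ] fun r : P.Rest n =>
        signal (α, r) i.rev (w i.rev) t := by
      rcases signal_eq_coord_or_zero hsep' (w i.rev) t with ⟨k, hk, h⟩ | h
      · rw [funext h]
        refine measurable_sigmaOf coord ?_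
        rintro ⟨l, rfl⟩
        exact rev_ne i (Option.some.inj hk).symm
      · rw [funext h]
        exact measurable_const
    have e : Y t = fun r => coord (symbolCoord i τ (w i j) t) r +
        (Real.sqrt (P.a i.rev) * signal (α, r) i.rev (w i.rev) t + coord (noiseCoord i t) r) :=
      funext fun r => received_of_mem_window hsep w hj ht r
    rw [e]
    exact hc.add ((hs.const_mul _).add hz)
  have hle : ∀ S : Set (P.Coord n), sigmaOf coord S ≤ (inferInstance : MeasurableSpace (P.Rest n)) :=
    fun S => iSup₂_le fun k _ => (measurable_coord k).comap_le
  have hmain := measure_le_sum_logb_likeRatio_le (Pr := P.restLaw n) (W := W) (X := X) (Y := Y)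
    (γ := P.γ i) (P.γ_pos i).ne' hσ0 (fun t _ => measurable_coord _)
    (fun t ht => (hYA t ht).mono (hle _) le_rfl)
    (fun t ht => hasLaw_symbolCoord (by have := hWm t ht; omega))
    ((P.iIndepFun_coord n).precomp (g := fun t : W => symbolCoord i τ m t) (fun s t h =>
      Subtype.ext (symbolCoord_inj (by have := hWm s s.2; omega) (by have := hWm t t.2; omega) h)))
    (indepFun_of_disjoint (P.iIndepFun_coord n) measurable_coord
      (disjoint_compl_right (a := A))
      (@measurable_pi_lambda _ _ _ (sigmaOf coord A) _ _ fun t => hXA t t.2)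
      (@measurable_pi_lambda _ _ _ (sigmaOf coord Aᶜ) _ _ fun t => hYA t t.2))
    (P.len n i * (P.φ i - 3 * ε) - (P.φ i - P.ψ i) *
        ∑ m ∈ Finset.Icc 1 (P.N i.rev), ((interfered (α, r₀) i j m).card : ℝ))
  refine (measure_mono fun r hr => ?_).trans hmain
  have hcardW := sum_window (s := ((α, r₀) : P.Sample n)) (i := i) (j := j) hsep' fun _ => 1
  simp only [Finset.sum_const, nsmul_eq_mul, mul_one] at hcardW
  have hWcard : ((window (α, r₀) i j).card : ℝ) = P.len n i := by
    rw [window, Nat.card_Icc]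
    congr 1
    omega
  rw [hWcard] at hcardW
  simp only [Set.mem_ofPred_eq]
  rw [hW, sum_window (s := ((α, r₀) : P.Sample n)) (i := i) (j := j) hsep']
  have h1 : ∀ l ∈ Finset.Icc 1 (P.N i.rev), ((interfered (α, r₀) i j l).card : ℝ) *
      (P.ψ i - 3 * ε) ≤ ∑ t ∈ interfered (α, r₀) i j l,
        Real.logb 2 (likeRatio (P.γ i) (σ t) (X t r) (Y t r)) := by
    intro l hl
    have h := sum_logb_likeRatio_ge (γ := P.γ i) (σ := P.interfVar i) (P.γ_pos i).ne'
      (interfVar_ne_zero i) (S := interfered (α, r₀) i j l) (x := fun t => X t r)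
      (y := fun t => Y t r) (ε := ε) fun hne => (hr.1 l hl hne).congr
        (fun t ht => place_codeword_eq (mem_interfered.1 ht).1 r) fun t _ => rfl
    have e : capFun ((P.γ i : ℝ) / P.interfVar i) = P.ψ i := by
      rw [ψ, interfVar]
      push_cast
      rfl
    rw [e] at h
    refine h.trans (le_of_eq (Finset.sum_congr rfl fun t ht => ?_))
    have : σ t = P.interfVar i := if_pos ⟨l, hl, ht⟩
    rw [this]
  have h2 : ∀ l ∈ Finset.Icc 0 (P.N i.rev), ((clean (α, r₀) i j l).card : ℝ) *
      (P.φ i - 3 * ε) ≤ ∑ t ∈ clean (α, r₀) i j l,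
        Real.logb 2 (likeRatio (P.γ i) (σ t) (X t r) (Y t r)) := by
    intro l hl
    have h := sum_logb_likeRatio_ge (γ := P.γ i) (σ := 1) (P.γ_pos i).ne'
      one_ne_zero (S := clean (α, r₀) i j l) (x := fun t => X t r)
      (y := fun t => Y t r) (ε := ε) fun hne => (hr.2 l hl hne).congr
        (fun t ht => place_codeword_eq (mem_clean.1 ht).1 r) fun t _ => rfl
    have e : capFun ((P.γ i : ℝ) / (1 : ℝ≥0)) = P.φ i := by
      rw [φ, NNReal.coe_one, div_one]
    rw [e] at h
    refine h.trans (le_of_eq (Finset.sum_congr rfl fun t ht => ?_))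
    have : σ t = 1 := if_neg fun ⟨l', hl', ht'⟩ =>
      notMem_burst_of_mem_clean hsep' hl ht l' hl' (mem_interfered.1 ht').2
    rw [this]
  have h3 := add_le_add (Finset.sum_le_sum h1) (Finset.sum_le_sum h2)
  rw [← Finset.sum_mul, ← Finset.sum_mul] at h3
  refine le_trans (le_of_eq ?_) h3
  rw [hcardW]
  ring

end FixedArrivals

end Params

namespace Params

variable {P : Params}

theorem mem_decodingError_of_schedTime_eq {n : ℕ} {ε : ℝ} {w : (i : Fin 2) → ℕ → P.Msg n i}
    {i : Fin 2} {j : ℕ} (hj : j ∈ Finset.Icc 1 (P.N i)) {α α' : Arrivals} {r : P.Rest n}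
    (h : ∀ u l, l ≤ P.N u + 1 → P.schedTime n u (α u) l = P.schedTime n u (α' u) l)
    (hα : (α, r) ∈ P.decodingError n ε w i j) : (α', r) ∈ P.decodingError n ε w i j := by
  have hτ : ∀ u l, l ≤ P.N u + 1 →
      tau ((α', r) : P.Sample n) u l = tau ((α, r) : P.Sample n) u l :=
    fun u l hl => (h u l hl).symm
  have hj' := Finset.mem_Icc.1 hj
  have hτj := hτ i j (by omega)
  have hsig : ∀ u v t, signal ((α', r) : P.Sample n) u v t = signal ((α, r) : P.Sample n) u v t := by
    intro u v t
    refine Finset.sum_congr rfl fun l hl => ?_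
    have hl' := Finset.mem_Icc.1 hl
    rw [hτ u l (by omega)]
  have hrec : received ((α', r) : P.Sample n) w i = received ((α, r) : P.Sample n) w i := by
    funext t
    simp only [received, hsig]
  have hwin : window ((α', r) : P.Sample n) i j = window ((α, r) : P.Sample n) i j := by
    simp only [window, hτj]
  have hint : ∀ l ∈ Finset.Icc 1 (P.N i.rev),
      interfered ((α', r) : P.Sample n) i j l = interfered ((α, r) : P.Sample n) i j l := by
    intro l hl
    have hl' := Finset.mem_Icc.1 hl
    simp only [interfered, hwin, hτ i.rev l (by omega)]
  have hcl : ∀ l ∈ Finset.Icc 0 (P.N i.rev),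
      clean ((α', r) : P.Sample n) i j l = clean ((α, r) : P.Sample n) i j l := by
    intro l hl
    have hl' := Finset.mem_Icc.1 hl
    simp only [clean, hwin, hτ i.rev l (by omega), hτ i.rev (l + 1) (by omega)]
  have hpass : ∀ m, Passes ((α', r) : P.Sample n) ε i j (received ((α', r) : P.Sample n) w i) m ↔
      Passes ((α, r) : P.Sample n) ε i j (received ((α, r) : P.Sample n) w i) m := by
    intro m
    rw [hrec]
    refine and_congr (forall₂_congr fun l hl => ?_) (forall₂_congr fun l hl => ?_)
    · rw [hint l hl, hτj]
    · rw [hcl l hl, hτj]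
  simp only [decodingError, Set.mem_ofPred_eq, hpass] at hα ⊢
  exact hα

theorem law_eq_prod (n : ℕ) : P.law n = P.arrivalLaw.prod (P.restLaw n) := rfl

theorem law_le_of_slices {n : ℕ} {ε : ℝ} {w : (i : Fin 2) → ℕ → P.Msg n i}
    {i : Fin 2} {j : ℕ} (hj : j ∈ Finset.Icc 1 (P.N i)) {B : Set Arrivals} {b : ℝ≥0∞}
    (hb : ∀ α ∉ B, P.restLaw n {r | (α, r) ∈ P.decodingError n ε w i j} ≤ b) :
    P.law n (P.decodingError n ε w i j) ≤ P.arrivalLaw B + b := by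
  rw [law_eq_prod]
  refine prod_measure_le_of_slices (f := fun (α : Arrivals) (u : Fin 2)
    (l : Fin (P.N u + 2)) => P.schedTime n u (α u) l) ?_ (fun α α' r hαα' hα => ?_) hb
  · exact measurable_pi_lambda _ fun u => measurable_pi_lambda _ fun l =>
      (P.measurable_schedTime n u l).comp (measurable_pi_apply u)
  · refine mem_decodingError_of_schedTime_eq hj (fun u l hl => ?_) hα
    exact congrFun (congrFun hαα' u) ⟨l, by omega⟩

theorem capFun_mono {x y : ℝ} (hx : 0 ≤ x) (hxy : x ≤ y) : capFun x ≤ capFun y := by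
  unfold capFun
  have := Real.logb_le_logb_of_le (b := 2) (by norm_num) (show 0 < 1 + x by linarith)
    (show 1 + x ≤ 1 + y by linarith)
  linarith

theorem φ_nonneg (i : Fin 2) : 0 ≤ P.φ i := by
  have h := capFun_mono le_rfl (P.γ i).coe_nonneg
  simpa [capFun, φ] using h

theorem ψ_le_φ (i : Fin 2) : P.ψ i ≤ P.φ i := by
  refine capFun_mono (by positivity) (div_le_self (P.γ i).coe_nonneg ?_)
  have : (0 : ℝ) ≤ P.a i.rev * P.γ i.rev := by positivity
  linarith

/-- Bound on the error probability for given arrivals. -/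
theorem restLaw_decodingError_le {n : ℕ} {δ ε : ℝ} {α : Arrivals} {i : Fin 2} {j : ℕ} (hn0 : 0 < n)
    (hε : 0 < ε) (hα : P.Concentrated n δ α) (hn : (P.preLen n : ℝ) + 1 ≤ δ * n)
    (hδ : P.Margin i j δ) (hj : j ∈ Finset.Icc 1 (P.N i)) (w : (i : Fin 2) → ℕ → P.Msg n i)
    (r₀ : P.Rest n) :
    P.restLaw n {r | (α, r) ∈ P.decodingError n ε w i j} ≤
      ∑ _m ∈ Finset.Icc 1 (P.N i.rev),
        ENNReal.ofReal (typicalityConst (P.γ i) (P.interfVar i) / (δ * ε ^ 2) / n) +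
      ∑ _m ∈ Finset.Icc 0 (P.N i.rev),
        ENNReal.ofReal (typicalityConst (P.γ i) 1 / (δ * ε ^ 2) / n) +
      ENNReal.ofReal (2 ^ (P.bits n i - (P.len n i * (P.φ i - 3 * ε) - (P.φ i - P.ψ i) *
        ∑ m ∈ Finset.Icc 1 (P.N i.rev), ((interfered (α, r₀) i j m).card : ℝ)))) := by
  have hsep := hα.separated hn (hδ.gap i)
  have hsep' := hα.separated hn (hδ.gap i.rev)
  have hn' : (0 : ℝ) < n := by exact_mod_cast hn0
  have hδ0 := hδ.pos
  have hconst : ∀ (K : ℝ) (c : ℕ), 0 ≤ K → 4 * δ * n ≤ c →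
      ENNReal.ofReal (4 * K / (c * ε ^ 2)) ≤ ENNReal.ofReal (K / (δ * ε ^ 2) / n) := by
    intro K c hK hc
    refine ENNReal.ofReal_le_ofReal ?_
    calc 4 * K / (c * ε ^ 2) ≤ 4 * K / (4 * δ * n * ε ^ 2) := by gcongr
      _ = K / (δ * ε ^ 2) / n := by field_simp
  set y : P.Rest n → ℕ → ℝ := fun r => received (α, r) w i
  set x : P.Rest n → ℕ → ℝ := fun r =>
    place (r.1 i (w i j)) (P.schedTime n i (α i) j + P.preLen n + 1)
  have hsub : {r | (α, r) ∈ P.decodingError n ε w i j} ⊆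
      ((⋃ m ∈ Finset.Icc 1 (P.N i.rev), {r | (interfered (α, r₀) i j m).Nonempty ∧
        ¬ JointlyTypical ε (P.densInterf i) (interfered (α, r₀) i j m) (x r) (y r)}) ∪
      (⋃ m ∈ Finset.Icc 0 (P.N i.rev), {r | (clean (α, r₀) i j m).Nonempty ∧
        ¬ JointlyTypical ε (P.densClean i) (clean (α, r₀) i j m) (x r) (y r)})) ∪
      ⋃ m, {r | m ≠ w i j ∧ Passes (α, r) ε i j (y r) m} := by
    intro r hr
    by_contra hcon
    simp only [Set.mem_union, Set.mem_iUnion, Set.mem_ofPred_eq, not_or, not_exists, not_and,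
      not_not] at hcon
    obtain ⟨⟨h1, h2⟩, h3⟩ := hcon
    refine hr fun m => ⟨fun hm => ?_, ?_⟩
    · by_contra hne
      exact h3 m hne hm
    · rintro rfl
      exact ⟨h1, h2⟩
  refine (measure_mono hsub).trans ((measure_union_le _ _).trans (add_le_add
    ((measure_union_le _ _).trans (add_le_add ?_ ?_)) ?_))
  · refine (measure_biUnion_finset_le _ _).trans (Finset.sum_le_sum fun m hm => ?_)
    by_cases hne : (interfered (α, r₀) i j m).Nonempty
    · refine (measure_mono fun r hr => And.right hr).trans
        ((measure_interfered_not_typical_le hsep hsep' w hj hm hne hε).trans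
        (hconst _ _ (typicalityConst_nonneg _ _) ?_))
      exact interfered_card_ge (s := ((α, r₀) : P.Sample n)) hα hn hδ hj hm hne
    · simp [hne]
  · refine (measure_biUnion_finset_le _ _).trans (Finset.sum_le_sum fun m hm => ?_)
    by_cases hne : (clean (α, r₀) i j m).Nonempty
    · refine (measure_mono fun r hr => And.right hr).trans
        ((measure_clean_not_typical_le hsep hsep' w hj hm hne hε).trans
        (hconst _ _ (typicalityConst_nonneg _ _) ?_))
      exact clean_card_ge (s := ((α, r₀) : P.Sample n)) hα hn hδ hj (Finset.mem_Icc.1 hm).2 hne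
    · simp [hne]
  · set E : ℝ := P.len n i * (P.φ i - 3 * ε) - (P.φ i - P.ψ i) *
        ∑ m ∈ Finset.Icc 1 (P.N i.rev), ((interfered (α, r₀) i j m).card : ℝ) with hE
    have hterm : ∀ m : P.Msg n i, P.restLaw n {r | m ≠ w i j ∧ Passes (α, r) ε i j (y r) m} ≤
        ENNReal.ofReal (2 ^ (-E)) := by
      intro m
      by_cases hm : m = w i j
      · simp [hm]
      · exact (measure_mono fun r hr => And.right hr).trans
          (measure_passes_le hsep hsep' w hj hm (r₀ := r₀))
    refine (measure_iUnion_fintype_le _ _).trans ((Finset.sum_le_sum fun m _ => hterm m).trans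
      (le_of_eq ?_))
    rw [Finset.sum_const, Finset.card_univ, Fintype.card_fin, nsmul_eq_mul, sub_eq_add_neg,
      Real.rpow_add (by norm_num), ENNReal.ofReal_mul (by positivity), Real.rpow_natCast]
    congr 1
    rw [ENNReal.ofReal_pow (by norm_num)]
    simp

theorem tendsto_ofReal_div_natCast (K : ℝ) :
    Tendsto (fun n : ℕ => ENNReal.ofReal (K / n)) atTop (𝓝 0) := by
  have h := ENNReal.tendsto_ofReal (tendsto_const_div_atTop_nhds_zero_nat K)
  rwa [ENNReal.ofReal_zero] at h

theorem tendsto_ofReal_two_rpow (c : ℝ) {κ : ℝ} (hκ : 0 < κ) :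
    Tendsto (fun n : ℕ => ENNReal.ofReal (2 ^ (c - κ * n))) atTop (𝓝 0) := by
  have h1 : Tendsto (fun n : ℕ => c - κ * n) atTop atBot := by
    simp_rw [sub_eq_add_neg]
    exact tendsto_atBot_add_const_left _ _
      (tendsto_neg_atTop_atBot.comp (tendsto_natCast_atTop_atTop.const_mul_atTop hκ))
  have h2 := ENNReal.tendsto_ofReal ((tendsto_rpow_atBot_of_base_gt_one 2 (by norm_num)).comp h1)
  rwa [ENNReal.ofReal_zero] at h2

end Params

end GIC

end

theorem proposition6 (P : GIC.Params) (himm : P.Immediate) (hres : P.NoCoincidence)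
    (i : Fin 2) (j : ℕ) (hj : j ∈ Finset.Icc 1 (P.N i))
    (hminus : P.omegaMinus i j ≠ 0) (hplus : P.omegaPlus i j = 0)
    (hhelp : (1 - (j : ℝ) / P.rate i * (P.φ i - P.ψ i)) * P.η i
        + (P.omegaMinus i j : ℝ) / P.rate i.rev * (P.φ i - P.ψ i) * P.η i.rev
      < P.θ i * P.φ i
        - (P.ν i.rev - P.ν i + P.θ i.rev * (1 + (P.omega i j : ℝ))) * (P.φ i - P.ψ i)) :
    P.ReliableDecoding i j := by
  open GIC GIC.Params in
  set Δ := P.φ i - P.ψ i with hΔ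
  have hΔ0 : 0 ≤ Δ := sub_nonneg.2 (ψ_le_φ i)
  set I := P.offset i j (P.omegaMinus i j) + P.θ i.rev * (1 + P.omega i j) with hI
  obtain ⟨κ, hκ⟩ : ∃ κ, κ = P.θ i * P.φ i - I * Δ - P.η i := ⟨_, rfl⟩
  have hκ0 : 0 < κ := by
    have e1 : (1 - (j : ℝ) / P.rate i * Δ) * P.η i = P.η i - j * P.μ i * Δ := by
      rw [Params.μ]
      ring
    have e2 : (P.omegaMinus i j : ℝ) / P.rate i.rev * Δ * P.η i.rev =
        P.omegaMinus i j * P.μ i.rev * Δ := by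
      rw [Params.μ]
      ring
    rw [e1, e2] at hhelp
    rw [hκ, hI, Params.offset]
    linarith
  have hθ := P.θ_pos i
  refine ⟨κ / (12 * P.θ i), by positivity, fun ε hε hε' w => ?_⟩
  have hεθ : 3 * ε * P.θ i ≤ κ / 4 := by
    rw [lt_div_iff₀ (by positivity)] at hε'
    linarith
  obtain ⟨δ, hδ, hδN⟩ : ∃ δ, P.Margin i j δ ∧ Δ * P.N i.rev * 4 * δ < κ / 4 := by
    refine ((P.eventually_margin himm hres i hj).and ?_).exists
    have : Tendsto (fun δ : ℝ => Δ * P.N i.rev * 4 * δ) (𝓝[>] 0) (𝓝 (Δ * P.N i.rev * 4 * 0)) :=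
      ((continuous_const.mul continuous_id).tendsto 0).mono_left nhdsWithin_le_nhds
    rw [mul_zero] at this
    exact this.eventually (gt_mem_nhds (by positivity))
  have hpre : ∀ᶠ n : ℕ in atTop, (P.preLen n : ℝ) + 1 ≤ δ * n := by
    have h1 := P.preLen_isLittleO.eventually (gt_mem_nhds (half_pos hδ.pos))
    have h2 := tendsto_natCast_atTop_atTop.eventually_ge_atTop (2 / δ)
    filter_upwards [h1, h2, eventually_gt_atTop 0] with n h1 h2 hn
    have hn' : (0 : ℝ) < n := by exact_mod_cast hn
    rw [div_lt_iff₀ hn'] at h1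
    rw [div_le_iff₀ hδ.pos] at h2
    linarith
  have hlim := (P.tendsto_measure_not_concentrated himm hδ.pos).add
    (((tendsto_finsetSum (Finset.Icc 1 (P.N i.rev)) fun _ _ => tendsto_ofReal_div_natCast
      (typicalityConst (P.γ i) (P.interfVar i) / (δ * ε ^ 2))).add
      (tendsto_finsetSum (Finset.Icc 0 (P.N i.rev)) fun _ _ => tendsto_ofReal_div_natCast
      (typicalityConst (P.γ i) 1 / (δ * ε ^ 2)))).add
      (tendsto_ofReal_two_rpow (P.φ i) (half_pos hκ0)))
  simp only [Finset.sum_const_zero, add_zero] at hlim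
  refine tendsto_of_tendsto_of_tendsto_of_le_of_le' tendsto_const_nhds hlim
    (Eventually.of_forall fun _ => zero_le) ?_
  filter_upwards [hpre, eventually_gt_atTop 0] with n hn hn0
  refine law_le_of_slices hj fun α hα => ?_
  have hα' : P.Concentrated n δ α := not_not.1 hα
  refine (restLaw_decodingError_le hn0 hε hα' hn hδ hj (w n) 0).trans ?_
  refine add_le_add le_rfl (ENNReal.ofReal_le_ofReal
    (Real.rpow_le_rpow_of_exponent_le (by norm_num) ?_))
  have hcard := sum_interfered_card_le (s := ((α, 0) : P.Sample n)) himm hα' hn hδ hj hminus hplus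
  rw [← hI] at hcard
  have hb := P.bits_le n i
  have hl := P.len_le n i
  have hl' : (n : ℝ) * P.θ i < P.len n i + 1 := Nat.lt_floor_add_one _
  have hn' : (0 : ℝ) < n := by exact_mod_cast hn0
  have h1 := mul_le_mul_of_nonneg_left hcard hΔ0
  have h2 := mul_le_mul_of_nonneg_right hl'.le (φ_nonneg (P := P) i)
  have h3 := mul_le_mul_of_nonneg_left hl (show 0 ≤ 3 * ε by positivity)
  have h4 := mul_le_mul_of_nonneg_left hεθ hn'.le
  have h5 := mul_le_mul_of_nonneg_left hδN.le hn'.le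
  have h6 : (n : ℝ) * κ = n * (P.θ i * P.φ i) - Δ * (n * I) - n * P.η i := by
    rw [hκ]
    ring
  rw [mul_add] at h1
  linarith
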